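/- Let $\mathbf{DCPO}$ be the category of directed-complete partial orders (every nonempty directed subset has a supremum; a least element is not required) and Scott-continuous functions, with its cartesian structure. Let $\mathbf{CPO}_{\perp!}$ be the category of pointed dcpos (dcpos with a least element) and strict (i.e. $\perp$-preserving) Scott-continuous functions, with the symmetric monoidal structure given by the smash product $\otimes$ and unit $1_\perp$. Let $(-)_\perp : \mathbf{DCPO} \to \mathbf{CPO}_{\perp!}$ be the lifting functor, which adds a new least element, and let $U : \mathbf{CPO}_{\perp!} \to \mathbf{DCPO}$ be the forgetful functor, with their canonical adjunction $(-)_\perp \dashv U$. Call an adjunction $F \dashv G$ with $F : \mathbf V \to \mathbf C$ a \emph{model of the CLNL calculus} if $\mathbf V$ is a cartesian closed category with finite coproducts, $\mathbf C$ is a symmetric monoidal closed category with finite coproducts, and $F \dashv G$ is a symmetric monoidal adjunction (that is, $F$ and $G$ carry lax symmetric monoidal structures for which the unit and counit are monoidal natural transformations). Call an endofunctor $T$ \emph{algebraically compact} if it has an initial algebra $\omega : T\Omega \to \Omega$ for which $\omega^{-1} : \Omega \to T\Omega$ is a final coalgebra, and call an endofunctor $T$ of a monoidal category $\mathbf C$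 \emph{parametrically algebraically compact} if $A \otimes T(-)$ is algebraically compact for every object $A$ of $\mathbf C$. A model of the CLNL calculus is a \emph{model of the CLNL calculus with recursion} if its endofunctor $! = F \circ G$ is parametrically algebraically compact. Theorem. The adjunction $(-)_\perp \dashv U$ between $\mathbf{DCPO}$ and $\mathbf{CPO}_{\perp!}$ is a model of the CLNL calculus with recursion. That is, $\mathbf{DCPO}$ is cartesian closed with finite coproducts, $\mathbf{CPO}_{\perp!}$ is symmetric monoidal closed (for the smash product) with finite coproducts, the adjunction is symmetric monoidal, and the endofunctor $! = (-)_\perp \circ U$ of $\mathbf{CPO}_{\perp!}$ is parametrically algebraically compact. -/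

import Mathlib

open CategoryTheory MonoidalCategory Limits

universe u v₁ u₁ v₂ u₂

/-! ### Algebraic compactness and models of the CLNL calculus -/

/-- An endofunctor `T` is algebraically compact if it has an initial algebra `ω : T Ω ⟶ Ω`
(whose structure map is then invertible) such that `ω⁻¹ : Ω ⟶ T Ω` is a final coalgebra. -/
def AlgebraicallyCompact {C : Type u₁} [Category.{v₁} C] (T : C ⥤ C) : Prop :=
  ∃ (Ω : C) (ω : T.obj Ω ≅ Ω),
    Nonempty (IsInitial (⟨Ω, ω.hom⟩ : Endofunctor.Algebra T)) ∧
    Nonempty (IsTerminal (⟨Ω, ω.inv⟩ : Endofunctor.Coalgebra T))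

/-- An endofunctor `T` of a monoidal category is parametrically algebraically compact if
`A ⊗ T(-)` is algebraically compact for every object `A`. -/
def ParametricallyAlgebraicallyCompact {C : Type u₁} [Category.{v₁} C] [MonoidalCategory C]
    (T : C ⥤ C) : Prop :=
  ∀ A : C, AlgebraicallyCompact (T ⋙ tensorLeft A)

/-- The adjunction `F ⊣ G` is a symmetric monoidal adjunction: `F` and `G` carry lax symmetric
monoidal structures for which the unit and the counit are monoidal natural transformations. -/
def IsSymmetricMonoidalAdjunction {V : Type u₁} [Category.{v₁} V] [MonoidalCategory V]
    [SymmetricCategory V] {C : Type u₂} [Category.{v₂} C] [MonoidalCategory C]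
    [SymmetricCategory C] {F : V ⥤ C} {G : C ⥤ V} (adj : F ⊣ G) : Prop :=
  ∃ (_ : F.LaxBraided) (_ : G.LaxBraided),
    NatTrans.IsMonoidal adj.unit ∧ NatTrans.IsMonoidal adj.counit

/-- A model of the CLNL calculus: a cartesian closed category `V` with finite coproducts, a
symmetric monoidal closed category `C` with finite coproducts, and a symmetric monoidal
adjunction between them. -/
structure IsCLNLModel {V : Type u₁} [Category.{v₁} V] [CartesianMonoidalCategory V]
    [SymmetricCategory V] {C : Type u₂} [Category.{v₂} C] [MonoidalCategory C]
    [SymmetricCategory C] {F : V ⥤ C} {G : C ⥤ V} (adj : F ⊣ G) : Prop where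
  cartesianClosed : Nonempty (MonoidalClosed V)
  hasFiniteCoproducts_left : HasFiniteCoproducts V
  monoidalClosed : Nonempty (MonoidalClosed C)
  hasFiniteCoproducts_right : HasFiniteCoproducts C
  symmetricMonoidal : IsSymmetricMonoidalAdjunction adj

/-- A model of the CLNL calculus with recursion: a CLNL model whose endofunctor `! = F ∘ G` is
parametrically algebraically compact. -/
structure IsCLNLModelWithRecursion {V : Type u₁} [Category.{v₁} V] [CartesianMonoidalCategory V]
    [SymmetricCategory V] {C : Type u₂} [Category.{v₂} C] [MonoidalCategory C]
    [SymmetricCategory C] {F : V ⥤ C} {G : C ⥤ V} (adj : F ⊣ G) : Prop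
    extends IsCLNLModel adj where
  bang_compact : ParametricallyAlgebraicallyCompact (G ⋙ F)

/-! ### Directed-complete partial orders and Scott-continuous functions -/

/-- A directed-complete partial order, possibly without a least element (and possibly empty):
every nonempty directed subset has a least upper bound. -/
structure DCPO : Type (u + 1) where
  carrier : Type u
  [str : PartialOrder carrier]
  exists_isLUB : ∀ d : Set carrier, d.Nonempty → DirectedOn (· ≤ ·) d → ∃ a, IsLUB d a

namespace DCPO

attribute [instance] DCPO.str

instance : CoeSort DCPO.{u} (Type u) := ⟨DCPO.carrier⟩

/-- Scott-continuous functions. -/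
@[ext]
structure Hom (X Y : DCPO.{u}) : Type u where
  toFun : X → Y
  scott : ScottContinuous toFun

instance : Category DCPO.{u} where
  Hom := Hom
  id X := ⟨id, ScottContinuous.id⟩
  comp f g := ⟨g.toFun ∘ f.toFun, f.scott.comp g.scott⟩

instance (X Y : DCPO.{u}) : FunLike (Hom X Y) X Y where
  coe f := f.toFun
  coe_injective := fun _ _ h => Hom.ext h

instance : ConcreteCategory DCPO.{u} Hom where
  hom f := f
  ofHom f := f

theorem hom_ext' {X Y : DCPO.{u}} {f g : X ⟶ Y} (h : ∀ x, f.toFun x = g.toFun x) : f = g :=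
  Hom.ext (funext h)

theorem exists_isLUB_prod {X Y : DCPO.{u}} (d : Set (X × Y)) (hd : d.Nonempty)
    (hd' : DirectedOn (· ≤ ·) d) : ∃ a, IsLUB d a := by
  obtain ⟨a, ha⟩ := X.exists_isLUB (Prod.fst '' d) (hd.image _) hd'.fst
  obtain ⟨b, hb⟩ := Y.exists_isLUB (Prod.snd '' d) (hd.image _) hd'.snd
  exact ⟨(a, b), isLUB_prod.2 ⟨ha, hb⟩⟩

/-- The product, ordered componentwise. -/
def prod (X Y : DCPO.{u}) : DCPO.{u} := ⟨X × Y, exists_isLUB_prod⟩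

/-- The one-point dcpo. -/
def one : DCPO.{u} := ⟨PUnit, fun _ _ _ => ⟨⟨⟩, fun _ _ => le_rfl, fun _ _ => le_rfl⟩⟩

/-- Cartesian structure on dcpos, with the componentwise product. -/
instance : CartesianMonoidalCategory DCPO.{u} :=
  CartesianMonoidalCategory.ofChosenFiniteProducts
    ⟨asEmptyCone one, IsTerminal.ofUniqueHom (fun _ => ⟨fun _ => PUnit.unit, ScottContinuous.const _⟩)
      (fun _ _ => hom_ext' fun _ => rfl)⟩
    (fun X Y =>
      ⟨BinaryFan.mk (P := prod X Y) ⟨Prod.fst, ScottContinuous.fst⟩ ⟨Prod.snd, ScottContinuous.snd⟩,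
        BinaryFan.isLimitMk
          (fun s => ⟨fun x => ((s.fst : Hom _ _).toFun x, (s.snd : Hom _ _).toFun x),
            ScottContinuous.prodMk (s.fst : Hom _ _).scott (s.snd : Hom _ _).scott⟩)
          (fun _ => rfl) (fun _ => rfl)
          (fun _ _ h₁ h₂ => hom_ext' fun x => Prod.ext
            (congrArg (fun k : Hom _ _ => k.toFun x) h₁)
            (congrArg (fun k : Hom _ _ => k.toFun x) h₂))⟩)

instance : BraidedCategory DCPO.{u} := .ofCartesianMonoidalCategory

end DCPO

/-! ### Pointed dcpos and strict Scott-continuous functions -/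

/-- A pointed dcpo: a dcpo with a least element. -/
structure PointedDCPO : Type (u + 1) where
  toDCPO : DCPO.{u}
  [bot : OrderBot toDCPO]

namespace PointedDCPO

attribute [instance] PointedDCPO.bot

instance : CoeSort PointedDCPO.{u} (Type u) := ⟨fun A => A.toDCPO⟩

/-- Strict (bottom-preserving) Scott-continuous functions. -/
@[ext]
structure Hom (A B : PointedDCPO.{u}) : Type u where
  toFun : A → B
  scott : ScottContinuous toFun
  strict : toFun ⊥ = ⊥

instance : Category PointedDCPO.{u} where
  Hom := Hom
  id X := ⟨id, ScottContinuous.id, rfl⟩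
  comp f g := ⟨g.toFun ∘ f.toFun, f.scott.comp g.scott, by simp [f.strict, g.strict]⟩

instance (A B : PointedDCPO.{u}) : FunLike (Hom A B) A B where
  coe f := f.toFun
  coe_injective := fun _ _ h => Hom.ext h

instance : ConcreteCategory PointedDCPO.{u} Hom where
  hom f := f
  ofHom f := f

theorem hom_ext' {A B : PointedDCPO.{u}} {f g : A ⟶ B} (h : ∀ x, f.toFun x = g.toFun x) : f = g :=
  Hom.ext (funext h)

theorem id_toFun (A : PointedDCPO.{u}) (x : A) : Hom.toFun (𝟙 A) x = x := rfl

theorem comp_toFun {A B C : PointedDCPO.{u}} (f : A ⟶ B) (g : B ⟶ C) (x : A) :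
    Hom.toFun (f ≫ g) x = g.toFun (f.toFun x) := rfl

/-- The forgetful functor. -/
def forgetful : PointedDCPO.{u} ⥤ DCPO.{u} where
  obj A := A.toDCPO
  map f := ⟨f.toFun, f.scott⟩

/-! ### Lifting -/

theorem withBot_isLUB_coe {X : Type u} [PartialOrder X] {d : Set (WithBot X)} {x : X} :
    IsLUB d (x : WithBot X) → (∃ y : X, (y : WithBot X) ∈ d) ∧
      IsLUB ((fun y : X => (y : WithBot X)) ⁻¹' d) x := by
  intro h
  refine ⟨?_, fun y hy => WithBot.coe_le_coe.1 (h.1 hy), fun z hz => ?_⟩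
  · by_contra! hne
    have : (x : WithBot X) ≤ ⊥ := h.2 fun y hy => by
      induction y with
      | bot => exact le_rfl
      | coe y => exact absurd hy (hne y)
    exact WithBot.coe_ne_bot (le_bot_iff.1 this)
  · refine WithBot.coe_le_coe.1 (h.2 fun y hy => ?_)
    induction y with
    | bot => exact bot_le
    | coe y => exact WithBot.coe_le_coe.2 (hz hy)

theorem withBot_directed {X : Type u} [PartialOrder X] {d : Set (WithBot X)}
    (hd : DirectedOn (· ≤ ·) d) :
    DirectedOn (· ≤ ·) ((fun y : X => (y : WithBot X)) ⁻¹' d) := by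
  intro a ha b hb
  obtain ⟨c, hc, hac, hbc⟩ := hd _ ha _ hb
  induction c with
  | bot => exact absurd (le_bot_iff.1 hac) WithBot.coe_ne_bot
  | coe c => exact ⟨c, hc, WithBot.coe_le_coe.1 hac, WithBot.coe_le_coe.1 hbc⟩

theorem withBot_exists_isLUB (X : DCPO.{u}) (d : Set (WithBot X)) (hd' : DirectedOn (· ≤ ·) d) :
    ∃ a, IsLUB d a := by
  by_cases h : ((fun y : X => (y : WithBot X)) ⁻¹' d).Nonempty
  · obtain ⟨a, ha⟩ := X.exists_isLUB _ h (withBot_directed hd')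
    refine ⟨a, fun y hy => ?_, fun z hz => ?_⟩
    · induction y with
      | bot => exact bot_le
      | coe y => exact WithBot.coe_le_coe.2 (ha.1 hy)
    · obtain ⟨y, hy⟩ := h
      have hyz := hz hy
      induction z with
      | bot => exact absurd (le_bot_iff.1 hyz) WithBot.coe_ne_bot
      | coe z => exact WithBot.coe_le_coe.2 (ha.2 fun w hw => WithBot.coe_le_coe.1 (hz hw))
  · refine ⟨⊥, fun y hy => ?_, fun _ _ => bot_le⟩
    induction y with
    | bot => exact le_rfl
    | coe y => exact absurd ⟨y, hy⟩ h

/-- The lifting `X_⊥`: a new least element is added. -/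
def liftObj (X : DCPO.{u}) : PointedDCPO.{u} where
  toDCPO := ⟨WithBot X, fun d _ hd => withBot_exists_isLUB X d hd⟩
  bot := inferInstanceAs (OrderBot (WithBot X))

/-- The inclusion `X ⟶ U (X_⊥)`. -/
def up (X : DCPO.{u}) : X ⟶ forgetful.obj (liftObj X) :=
  ⟨fun x => (x : WithBot X), by
    intro d hd _ a ha
    refine ⟨?_, fun z hz => ?_⟩
    · rintro _ ⟨y, hy, rfl⟩
      exact WithBot.coe_le_coe.2 (ha.1 hy)
    · obtain ⟨y, hy⟩ := hd
      have hyz : (y : WithBot X) ≤ z := hz ⟨y, hy, rfl⟩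
      change WithBot X at z
      induction z with
      | bot => exact absurd (le_bot_iff.1 hyz) WithBot.coe_ne_bot
      | coe z =>
        exact WithBot.coe_le_coe.2 (ha.2 fun w hw => WithBot.coe_le_coe.1 (hz ⟨w, hw, rfl⟩))⟩

/-- The strict extension to `X_⊥` of a Scott-continuous function. -/
def extend {X : DCPO.{u}} {A : PointedDCPO.{u}} (f : X ⟶ forgetful.obj A) : liftObj X ⟶ A where
  toFun := WithBot.recBotCoe ⊥ (fun x => f.toFun x)
  strict := rfl
  scott := by
    intro d hd hd' a ha
    change WithBot X at a
    induction a with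
    | bot =>
      refine ⟨?_, fun _ _ => bot_le⟩
      rintro _ ⟨y, hy, rfl⟩
      rw [show y = ⊥ from le_bot_iff.1 (ha.1 hy)]
      exact le_rfl
    | coe a =>
      obtain ⟨⟨y, hy⟩, hl⟩ := withBot_isLUB_coe ha
      have key := f.scott ⟨y, hy⟩ (withBot_directed hd') hl
      refine ⟨?_, fun z hz => key.2 ?_⟩
      · rintro _ ⟨w, hw, rfl⟩
        change WithBot X at w
        induction w with
        | bot => exact bot_le
        | coe w => exact key.1 ⟨w, hw, rfl⟩
      · rintro _ ⟨w, hw, rfl⟩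
        exact hz ⟨(w : WithBot X), hw, rfl⟩

theorem lift_hom_ext {X : DCPO.{u}} {A : PointedDCPO.{u}} {f g : liftObj X ⟶ A}
    (h : ∀ x : X, f.toFun (x : WithBot X) = g.toFun (x : WithBot X)) : f = g :=
  hom_ext' fun x => by
    change WithBot X at x
    induction x with
    | bot => exact f.strict.trans g.strict.symm
    | coe x => exact h x

/-- The lifting functor. -/
def lifting : DCPO.{u} ⥤ PointedDCPO.{u} where
  obj := liftObj
  map {_ Y} f := extend (f ≫ up Y)
  map_id _ := lift_hom_ext fun _ => rfl
  map_comp _ _ := lift_hom_ext fun _ => rfl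

/-- Lifting is left adjoint to the forgetful functor. -/
def liftingAdj : lifting.{u} ⊣ forgetful.{u} :=
  Adjunction.mkOfHomEquiv
    { homEquiv := fun X _ =>
        { toFun := fun f => up X ≫ forgetful.map f
          invFun := fun f => extend f
          left_inv := fun _ => lift_hom_ext fun _ => rfl
          right_inv := fun _ => rfl }
      homEquiv_naturality_left_symm := fun _ _ => lift_hom_ext fun _ => rfl
      homEquiv_naturality_right := fun _ _ => rfl }

/-! ### The smash product -/

/-- The smash product of pointed dcpos: the pairs in which both entries or neither entry is the
least element, ordered componentwise. -/
abbrev Smash (A B : PointedDCPO.{u}) : Type u :=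
  {p : A × B // p.1 = ⊥ ↔ p.2 = ⊥}

theorem isLUB_fst_eq_bot_iff {A B : PointedDCPO.{u}} {d : Set (Smash A B)} {p : A × B}
    (h : IsLUB (Subtype.val '' d) p) : p.1 = ⊥ ↔ p.2 = ⊥ := by
  have h' := isLUB_prod.1 h
  constructor
  · intro hp
    refine le_bot_iff.1 (h'.2.2 ?_)
    rintro _ ⟨_, ⟨s, hs, rfl⟩, rfl⟩
    exact (s.2.1 (le_bot_iff.1 ((h'.1.1 ⟨_, ⟨s, hs, rfl⟩, rfl⟩).trans hp.le))).le
  · intro hp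
    refine le_bot_iff.1 (h'.1.2 ?_)
    rintro _ ⟨_, ⟨s, hs, rfl⟩, rfl⟩
    exact (s.2.2 (le_bot_iff.1 ((h'.2.1 ⟨_, ⟨s, hs, rfl⟩, rfl⟩).trans hp.le))).le

theorem smash_isLUB {A B : PointedDCPO.{u}} {d : Set (Smash A B)} {p : A × B}
    (h : IsLUB (Subtype.val '' d) p) : IsLUB d (⟨p, isLUB_fst_eq_bot_iff h⟩ : Smash A B) :=
  ⟨fun s hs => h.1 ⟨s, hs, rfl⟩, fun z hz => h.2 (by rintro _ ⟨s, hs, rfl⟩; exact hz hs)⟩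

theorem smash_val_directed {A B : PointedDCPO.{u}} {d : Set (Smash A B)}
    (hd : DirectedOn (· ≤ ·) d) : DirectedOn (· ≤ ·) (Subtype.val '' d) := by
  rintro _ ⟨s, hs, rfl⟩ _ ⟨t, ht, rfl⟩
  obtain ⟨r, hr, h₁, h₂⟩ := hd s hs t ht
  exact ⟨r.1, ⟨r, hr, rfl⟩, h₁, h₂⟩

theorem smash_exists_isLUB {A B : PointedDCPO.{u}} (d : Set (Smash A B)) (hd : d.Nonempty)
    (hd' : DirectedOn (· ≤ ·) d) : ∃ a, IsLUB d a := by
  obtain ⟨p, hp⟩ := DCPO.exists_isLUB_prod _ (hd.image _) (smash_val_directed hd')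
  exact ⟨_, smash_isLUB hp⟩

theorem smash_val_scott {A B : PointedDCPO.{u}} :
    ScottContinuous (Subtype.val : Smash A B → A × B) := by
  intro d hd hd' a ha
  obtain ⟨p, hp⟩ := DCPO.exists_isLUB_prod _ (hd.image _) (smash_val_directed hd')
  rw [ha.unique (smash_isLUB hp)]
  exact hp

/-- The smash product as a pointed dcpo. -/
def smash (A B : PointedDCPO.{u}) : PointedDCPO.{u} where
  toDCPO := ⟨Smash A B, smash_exists_isLUB⟩
  bot := { bot := (⟨(⊥, ⊥), by simp⟩ : Smash A B)
           bot_le := fun _ => ⟨bot_le, bot_le⟩ }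

open Classical in
/-- The pair `a ⊗ b` in the smash product, which is the least element as soon as one of the
entries is. -/
noncomputable def pair {A B : PointedDCPO.{u}} (a : A) (b : B) : smash A B :=
  if h : a = ⊥ ∨ b = ⊥ then ⊥ else (⟨(a, b), by tauto⟩ : Smash A B)

theorem pair_bot_left {A B : PointedDCPO.{u}} (b : B) : pair (⊥ : A) b = ⊥ := by simp [pair]

theorem pair_bot_right {A B : PointedDCPO.{u}} (a : A) : pair a (⊥ : B) = ⊥ := by simp [pair]

theorem pair_of_ne {A B : PointedDCPO.{u}} {a : A} {b : B} (ha : a ≠ ⊥) (hb : b ≠ ⊥) :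
    pair a b = (⟨(a, b), by tauto⟩ : Smash A B) := by
  exact dif_neg (not_or.2 ⟨ha, hb⟩)

theorem pair_val {A B : PointedDCPO.{u}} (s : Smash A B) :
    (pair s.1.1 s.1.2 : smash A B) = s := by
  obtain ⟨⟨a, b⟩, h⟩ := s
  by_cases ha : a = ⊥
  · have hb : b = ⊥ := h.1 ha
    subst ha hb
    exact pair_bot_left _
  · exact pair_of_ne ha (fun hb => ha (h.2 hb))

theorem pair_le {A B : PointedDCPO.{u}} {a : A} {b : B} {s : Smash A B}
    (h : b ≠ ⊥ → a ≠ ⊥ → a ≤ s.1.1 ∧ b ≤ s.1.2) : (pair a b : smash A B) ≤ s := by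
  by_cases ha : a = ⊥
  · subst ha; rw [pair_bot_left]; exact bot_le
  by_cases hb : b = ⊥
  · subst hb; rw [pair_bot_right]; exact bot_le
  rw [pair_of_ne ha hb]
  exact h hb ha

theorem le_of_pair_le {A B : PointedDCPO.{u}} {a : A} {b : B} {s : Smash A B}
    (h : (pair a b : smash A B) ≤ s) (ha : a ≠ ⊥) (hb : b ≠ ⊥) : a ≤ s.1.1 ∧ b ≤ s.1.2 := by
  rw [pair_of_ne ha hb] at h
  exact h

theorem exists_ne_bot_of_isLUB {A : PointedDCPO.{u}} {d : Set A} {a : A} (h : IsLUB d a)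
    (ha : a ≠ ⊥) : ∃ x ∈ d, x ≠ ⊥ := by
  by_contra! hne
  exact ha (le_bot_iff.1 (h.2 fun x hx => (hne x hx).le))

theorem pair_scott {A B : PointedDCPO.{u}} :
    ScottContinuous (fun p : A × B => (pair p.1 p.2 : smash A B)) := by
  refine ScottContinuous.fromProd (fun a d _ _ b hb => ⟨?_, fun z hz => ?_⟩)
    (fun b d _ _ a ha => ⟨?_, fun z hz => ?_⟩)
  · rintro _ ⟨y, hy, rfl⟩
    refine pair_le fun hy0 ha0 => ?_
    have hb0 : b ≠ ⊥ := fun h => hy0 (le_bot_iff.1 (h ▸ hb.1 hy))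
    exact le_of_pair_le (s := pair a b) le_rfl ha0 hb0 |>.imp id (hb.1 hy).trans
  · refine pair_le fun hb0 ha0 => ?_
    obtain ⟨y, hy, hy0⟩ := exists_ne_bot_of_isLUB hb hb0
    refine ⟨(le_of_pair_le (hz ⟨y, hy, rfl⟩) ha0 hy0).1, hb.2 fun w hw => ?_⟩
    by_cases hw0 : w = ⊥
    · rw [hw0]; exact bot_le
    · exact (le_of_pair_le (hz ⟨w, hw, rfl⟩) ha0 hw0).2
  · rintro _ ⟨y, hy, rfl⟩
    refine pair_le fun hb0 hy0 => ?_
    have ha0 : a ≠ ⊥ := fun h => hy0 (le_bot_iff.1 (h ▸ ha.1 hy))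
    exact le_of_pair_le (s := pair a b) le_rfl ha0 hb0 |>.imp (ha.1 hy).trans id
  · refine pair_le fun hb0 ha0 => ?_
    obtain ⟨y, hy, hy0⟩ := exists_ne_bot_of_isLUB ha ha0
    refine ⟨ha.2 fun w hw => ?_, (le_of_pair_le (hz ⟨y, hy, rfl⟩) hy0 hb0).2⟩
    by_cases hw0 : w = ⊥
    · rw [hw0]; exact bot_le
    · exact (le_of_pair_le (hz ⟨w, hw, rfl⟩) hw0 hb0).1

/-- The strict map out of the smash product given by a Scott-continuous function of two
variables. -/
def smashDesc {A B C : PointedDCPO.{u}} (f : A × B → C) (hf : ScottContinuous f)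
    (h : f (⊥, ⊥) = ⊥) : smash A B ⟶ C where
  toFun (s : Smash A B) := f s.1
  scott := smash_val_scott.comp hf
  strict := h

theorem smashDesc_pair {A B C : PointedDCPO.{u}} (f : A × B → C) (hf : ScottContinuous f)
    (h₁ : ∀ b, f (⊥, b) = ⊥) (h₂ : ∀ a, f (a, ⊥) = ⊥) (a : A) (b : B) :
    (smashDesc f hf (h₁ ⊥)).toFun (pair a b) = f (a, b) := by
  by_cases ha : a = ⊥
  · subst ha; rw [pair_bot_left, h₁]; exact h₁ _
  by_cases hb : b = ⊥
  · subst hb; rw [pair_bot_right, h₂]; exact h₁ _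
  rw [pair_of_ne ha hb]
  rfl

theorem smash_hom_ext {A B C : PointedDCPO.{u}} {f g : smash A B ⟶ C}
    (h : ∀ a b, f.toFun (pair a b) = g.toFun (pair a b)) : f = g :=
  hom_ext' fun s => by
    rw [← pair_val s]
    exact h _ _

theorem smash_hom_ext₃ {A B C D : PointedDCPO.{u}} {f g : smash (smash A B) C ⟶ D}
    (h : ∀ a b c, f.toFun (pair (pair a b) c) = g.toFun (pair (pair a b) c)) : f = g :=
  smash_hom_ext fun s c => by
    rw [← pair_val s]
    exact h _ _ _

theorem smash_hom_ext₃' {A B C D : PointedDCPO.{u}} {f g : smash A (smash B C) ⟶ D}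
    (h : ∀ a b c, f.toFun (pair a (pair b c)) = g.toFun (pair a (pair b c))) : f = g :=
  smash_hom_ext fun a s => by
    rw [← pair_val s]
    exact h _ _ _

theorem smash_hom_ext₄ {A B C D E : PointedDCPO.{u}} {f g : smash (smash (smash A B) C) D ⟶ E}
    (h : ∀ a b c d, f.toFun (pair (pair (pair a b) c) d) =
      g.toFun (pair (pair (pair a b) c) d)) : f = g :=
  smash_hom_ext₃ fun s c d => by
    rw [← pair_val s]
    exact h _ _ _ _

/-- The action of the smash product on strict maps. -/
noncomputable def smashMap {A B A' B' : PointedDCPO.{u}} (f : A ⟶ A') (g : B ⟶ B') :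
    smash A B ⟶ smash A' B' :=
  smashDesc (fun p => pair (f.toFun p.1) (g.toFun p.2))
    ((ScottContinuous.prod f.scott g.scott).comp pair_scott) (by rw [f.strict, pair_bot_left])

theorem smashMap_pair {A B A' B' : PointedDCPO.{u}} (f : A ⟶ A') (g : B ⟶ B') (a : A) (b : B) :
    (smashMap f g).toFun (pair a b) = pair (f.toFun a) (g.toFun b) :=
  smashDesc_pair _ _ (fun _ => by rw [f.strict, pair_bot_left])
    (fun _ => by rw [g.strict, pair_bot_right]) a b

/-- The symmetry `(a, b) ↦ (b, a)`. -/
noncomputable def smashSwap (A B : PointedDCPO.{u}) : smash A B ⟶ smash B A :=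
  smashDesc (fun p => pair p.2 p.1)
    ((ScottContinuous.prodMk ScottContinuous.snd ScottContinuous.fst).comp pair_scott)
    (pair_bot_left _)

theorem smashSwap_pair {A B : PointedDCPO.{u}} (a : A) (b : B) :
    (smashSwap A B).toFun (pair a b) = pair b a :=
  smashDesc_pair _ _ (fun _ => pair_bot_right _) (fun _ => pair_bot_left _) a b

/-- The associativity map `((a, b), c) ↦ (a, (b, c))`. -/
noncomputable def smashAssoc (A B C : PointedDCPO.{u}) :
    smash (smash A B) C ⟶ smash A (smash B C) :=
  smashDesc (fun p : Smash A B × C => pair p.1.1.1 (pair p.1.1.2 p.2))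
    ((ScottContinuous.prodMk
      ((ScottContinuous.fst.comp smash_val_scott).comp ScottContinuous.fst)
      ((ScottContinuous.prodMk
        ((ScottContinuous.fst.comp smash_val_scott).comp ScottContinuous.snd)
        ScottContinuous.snd).comp pair_scott)).comp pair_scott)
    (pair_bot_left _)

theorem smashAssoc_pair {A B C : PointedDCPO.{u}} (a : A) (b : B) (c : C) :
    (smashAssoc A B C).toFun (pair (pair a b) c) = pair a (pair b c) := by
  refine (smashDesc_pair _ _ (fun _ => pair_bot_left _)
    (fun _ => by rw [pair_bot_right, pair_bot_right]) (pair a b) c).trans ?_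
  by_cases ha : a = ⊥
  · subst ha; rw [pair_bot_left, pair_bot_left]; exact pair_bot_left _
  by_cases hb : b = ⊥
  · subst hb; rw [pair_bot_right, pair_bot_left, pair_bot_right]; exact pair_bot_left _
  rw [pair_of_ne ha hb]

/-- The associativity map `(a, (b, c)) ↦ ((a, b), c)`. -/
noncomputable def smashAssocInv (A B C : PointedDCPO.{u}) :
    smash A (smash B C) ⟶ smash (smash A B) C :=
  smashDesc (fun p : A × Smash B C => pair (pair p.1 p.2.1.1) p.2.1.2)
    ((ScottContinuous.prodMk
      ((ScottContinuous.prodMk ScottContinuous.fst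
        ((ScottContinuous.snd.comp smash_val_scott).comp ScottContinuous.fst)).comp pair_scott)
      ((ScottContinuous.snd.comp smash_val_scott).comp ScottContinuous.snd)).comp pair_scott)
    (pair_bot_right _)

theorem smashAssocInv_pair {A B C : PointedDCPO.{u}} (a : A) (b : B) (c : C) :
    (smashAssocInv A B C).toFun (pair a (pair b c)) = pair (pair a b) c := by
  refine (smashDesc_pair _ _ (fun _ => by rw [pair_bot_left, pair_bot_left])
    (fun _ => pair_bot_right _) a (pair b c)).trans ?_
  by_cases hb : b = ⊥
  · subst hb; rw [pair_bot_left, pair_bot_right, pair_bot_left]; exact pair_bot_right _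
  by_cases hc : c = ⊥
  · subst hc; rw [pair_bot_right, pair_bot_right]; exact pair_bot_right _
  rw [pair_of_ne hb hc]

/-- The unit of the smash product: the two-element chain `1_⊥`. -/
def sierpinski : PointedDCPO.{u} := liftObj DCPO.one

/-- The top element of `1_⊥`. -/
def sierpinskiTop : sierpinski.{u} := ((PUnit.unit : PUnit.{u + 1}) : WithBot PUnit.{u + 1})

theorem sierpinskiTop_ne : sierpinskiTop.{u} ≠ ⊥ :=
  WithBot.coe_ne_bot (a := (PUnit.unit : PUnit.{u + 1}))

theorem eq_sierpinskiTop {i : sierpinski.{u}} (h : i ≠ ⊥) : i = sierpinskiTop := by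
  change WithBot PUnit at i
  induction i with
  | bot => exact absurd rfl h
  | coe _ => rfl

/-- The left unit map; on pairs it sends `(⊤, a)` to `a` and `(⊥, a)` to `⊥`. -/
def smashLeft (A : PointedDCPO.{u}) : smash sierpinski A ⟶ A :=
  smashDesc Prod.snd ScottContinuous.snd rfl

/-- The inverse left unit map `a ↦ (⊤, a)`. -/
noncomputable def smashLeftInv (A : PointedDCPO.{u}) : A ⟶ smash sierpinski A where
  toFun a := pair sierpinskiTop a
  scott := (ScottContinuous.prodMk (ScottContinuous.const sierpinskiTop)
    ScottContinuous.id).comp pair_scott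
  strict := pair_bot_right _

theorem smashLeft_pair {A : PointedDCPO.{u}} (a : A) :
    (smashLeft A).toFun (pair sierpinskiTop a) = a := by
  by_cases ha : a = ⊥
  · subst ha; rw [pair_bot_right]; rfl
  · rw [pair_of_ne sierpinskiTop_ne ha]; rfl

/-- The right unit map; on pairs it sends `(a, ⊤)` to `a` and `(a, ⊥)` to `⊥`. -/
def smashRight (A : PointedDCPO.{u}) : smash A sierpinski ⟶ A :=
  smashDesc Prod.fst ScottContinuous.fst rfl

/-- The inverse right unit map `a ↦ (a, ⊤)`. -/
noncomputable def smashRightInv (A : PointedDCPO.{u}) : A ⟶ smash A sierpinski where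
  toFun a := pair a sierpinskiTop
  scott := (ScottContinuous.prodMk ScottContinuous.id
    (ScottContinuous.const sierpinskiTop)).comp pair_scott
  strict := pair_bot_left _

theorem smashRight_pair {A : PointedDCPO.{u}} (a : A) :
    (smashRight A).toFun (pair a sierpinskiTop) = a := by
  by_cases ha : a = ⊥
  · subst ha; rw [pair_bot_left]; rfl
  · rw [pair_of_ne ha sierpinskiTop_ne]; rfl

theorem smashLeft_hom_ext {A B : PointedDCPO.{u}} {f g : smash sierpinski A ⟶ B}
    (h : ∀ a, f.toFun (pair sierpinskiTop a) = g.toFun (pair sierpinskiTop a)) : f = g :=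
  smash_hom_ext fun i a => by
    by_cases hi : i = ⊥
    · subst hi; rw [pair_bot_left]; exact f.strict.trans g.strict.symm
    · rw [eq_sierpinskiTop hi]; exact h a

theorem smashRight_hom_ext {A B : PointedDCPO.{u}} {f g : smash A sierpinski ⟶ B}
    (h : ∀ a, f.toFun (pair a sierpinskiTop) = g.toFun (pair a sierpinskiTop)) : f = g :=
  smash_hom_ext fun a i => by
    by_cases hi : i = ⊥
    · subst hi; rw [pair_bot_right]; exact f.strict.trans g.strict.symm
    · rw [eq_sierpinskiTop hi]; exact h a

theorem triangle_hom_ext {A B C : PointedDCPO.{u}} {f g : smash (smash A sierpinski) B ⟶ C}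
    (h : ∀ a b, f.toFun (pair (pair a sierpinskiTop) b) =
      g.toFun (pair (pair a sierpinskiTop) b)) : f = g :=
  smash_hom_ext₃ fun a i b => by
    by_cases hi : i = ⊥
    · subst hi; rw [pair_bot_right, pair_bot_left]; exact f.strict.trans g.strict.symm
    · rw [eq_sierpinskiTop hi]; exact h a b

noncomputable instance : MonoidalCategoryStruct PointedDCPO.{u} where
  tensorObj := smash
  tensorUnit := sierpinski
  tensorHom := smashMap
  whiskerLeft A _ _ f := smashMap (𝟙 A) f
  whiskerRight f B := smashMap f (𝟙 B)
  associator A B C :=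
    { hom := smashAssoc A B C
      inv := smashAssocInv A B C
      hom_inv_id := smash_hom_ext₃ fun a b c => by
        rw [comp_toFun, smashAssoc_pair, smashAssocInv_pair]; rfl
      inv_hom_id := smash_hom_ext₃' fun a b c => by
        rw [comp_toFun, smashAssocInv_pair, smashAssoc_pair]; rfl }
  leftUnitor A :=
    { hom := smashLeft A
      inv := smashLeftInv A
      hom_inv_id := smashLeft_hom_ext fun a => by
        rw [comp_toFun, smashLeft_pair]; rfl
      inv_hom_id := hom_ext' fun a => smashLeft_pair a }
  rightUnitor A :=
    { hom := smashRight A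
      inv := smashRightInv A
      hom_inv_id := smashRight_hom_ext fun a => by
        rw [comp_toFun, smashRight_pair]; rfl
      inv_hom_id := hom_ext' fun a => smashRight_pair a }

/-- The symmetric monoidal structure on pointed dcpos given by the smash product. -/
noncomputable instance : MonoidalCategory PointedDCPO.{u} :=
  MonoidalCategory.ofTensorHom
    (id_tensorHom_id := fun A B => smash_hom_ext fun a b => smashMap_pair _ _ a b)
    (tensorHom_comp_tensorHom := fun f₁ f₂ g₁ g₂ => smash_hom_ext fun a b => by
      change (smashMap g₁ g₂).toFun ((smashMap f₁ f₂).toFun _) = (smashMap _ _).toFun _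
      simp only [smashMap_pair, comp_toFun])
    (associator_naturality := fun f₁ f₂ f₃ => smash_hom_ext₃ fun a b c => by
      change (smashAssoc _ _ _).toFun ((smashMap (smashMap f₁ f₂) f₃).toFun _) =
        (smashMap f₁ (smashMap f₂ f₃)).toFun ((smashAssoc _ _ _).toFun _)
      simp only [smashMap_pair, smashAssoc_pair])
    (leftUnitor_naturality := fun f => smashLeft_hom_ext fun a => by
      change (smashLeft _).toFun ((smashMap (𝟙 sierpinski) f).toFun _) =
        f.toFun ((smashLeft _).toFun _)
      simp only [smashMap_pair, id_toFun, smashLeft_pair])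
    (rightUnitor_naturality := fun f => smashRight_hom_ext fun a => by
      change (smashRight _).toFun ((smashMap f (𝟙 sierpinski)).toFun _) =
        f.toFun ((smashRight _).toFun _)
      simp only [smashMap_pair, id_toFun, smashRight_pair])
    (pentagon := fun A B C D => smash_hom_ext₄ fun a b c d => by
      change (smashMap (𝟙 A) (smashAssoc B C D)).toFun ((smashAssoc A (smash B C) D).toFun
          ((smashMap (smashAssoc A B C) (𝟙 D)).toFun _)) =
        (smashAssoc A B (smash C D)).toFun ((smashAssoc (smash A B) C D).toFun _)
      simp only [smashMap_pair, id_toFun, smashAssoc_pair])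
    (triangle := fun A B => triangle_hom_ext fun a b => by
      change (smashMap (𝟙 A) (smashLeft B)).toFun ((smashAssoc A sierpinski B).toFun _) =
        (smashMap (smashRight A) (𝟙 B)).toFun _
      simp only [smashMap_pair, id_toFun, smashAssoc_pair, smashLeft_pair, smashRight_pair])

noncomputable instance : SymmetricCategory PointedDCPO.{u} where
  braiding A B :=
    { hom := smashSwap A B
      inv := smashSwap B A
      hom_inv_id := smash_hom_ext fun a b => by
        rw [comp_toFun, smashSwap_pair, smashSwap_pair]; rfl
      inv_hom_id := smash_hom_ext fun a b => by
        rw [comp_toFun, smashSwap_pair, smashSwap_pair]; rfl }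
  braiding_naturality_right A B C f := smash_hom_ext fun a b => by
    change (smashSwap _ _).toFun ((smashMap (𝟙 A) f).toFun _) =
      (smashMap f (𝟙 A)).toFun ((smashSwap _ _).toFun _)
    simp only [smashMap_pair, id_toFun, smashSwap_pair]
  braiding_naturality_left {A B} f C := smash_hom_ext fun a b => by
    change (smashSwap _ _).toFun ((smashMap f (𝟙 C)).toFun _) =
      (smashMap (𝟙 C) f).toFun ((smashSwap _ _).toFun _)
    simp only [smashMap_pair, id_toFun, smashSwap_pair]
  hexagon_forward A B C := smash_hom_ext₃ fun a b c => by
    change (smashAssoc B C A).toFun ((smashSwap A (smash B C)).toFun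
        ((smashAssoc A B C).toFun _)) =
      (smashMap (𝟙 B) (smashSwap A C)).toFun ((smashAssoc B A C).toFun
        ((smashMap (smashSwap A B) (𝟙 C)).toFun _))
    simp only [smashMap_pair, id_toFun, smashSwap_pair, smashAssoc_pair]
  hexagon_reverse A B C := smash_hom_ext₃' fun a b c => by
    change (smashAssocInv C A B).toFun ((smashSwap (smash A B) C).toFun
        ((smashAssocInv A B C).toFun _)) =
      (smashMap (smashSwap A C) (𝟙 B)).toFun ((smashAssocInv A C B).toFun
        ((smashMap (𝟙 A) (smashSwap B C)).toFun _))
    simp only [smashMap_pair, id_toFun, smashSwap_pair, smashAssocInv_pair]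
  symmetry A B := smash_hom_ext fun a b => by
    change (smashSwap B A).toFun ((smashSwap A B).toFun _) = _
    rw [smashSwap_pair, smashSwap_pair]; rfl

end PointedDCPO

/-! Function spaces, coalesced sums and sequence spaces are all cut out of a product or a power by a
condition stable under directed suprema, so their suprema are computed in the ambient order
(`DirectedClosed`). Scott-continuous maps, ordered pointwise, give the exponential of `DCPO`; strict
ones give the internal hom for the smash product. Coproducts are disjoint sums in `DCPO` and
coalesced sums in `PointedDCPO`.

The adjunction is monoidal because a strict map out of a smash product of liftings is determined by
its values on pairs of lifted elements. There the comparison map is `(x, y) ↦ x ⊗ y` read backwards,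
and every coherence law is a computation on such generators.

For compactness, the functor `X ↦ A ⊗ X_⊥` has an explicit fixed point: the sequences in `A` that
stay at `⊥` once they reach it. A non-bottom element of `A ⊗ Ω_⊥` is a head `a ≠ ⊥` with a tail in
`Ω`. Lifting the tail separates "head `a`, then `⊥` forever" from the bottom sequence.

Initiality is a Kleene argument: the algebra map is the supremum of the approximations `foldApprox`,
and it is unique because the approximations of the identity are the truncations of a sequence, whose
supremum is the sequence (`foldApprox_cons_isLUB`, `eq_fold`). Finality is proved entrywise:
iterating a coalgebra yields the entries of `unfold`, and a coalgebra map has each entry forced by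
induction (`coalg_hom_unique`). -/

/-! ### Directed completeness of function spaces and of subtypes -/

section Order

variable {X Y ι : Type*} [PartialOrder X] [PartialOrder Y]

/-- A predicate on a partial order that is closed under the suprema of nonempty directed sets. -/
def DirectedClosed (P : X → Prop) : Prop :=
  ∀ d : Set X, d.Nonempty → DirectedOn (· ≤ ·) d → (∀ x ∈ d, P x) → ∀ a, IsLUB d a → P a

theorem Monotone.image_directedOn {f : X → Y} (hf : Monotone f) {d : Set X}
    (hd : DirectedOn (· ≤ ·) d) : DirectedOn (· ≤ ·) (f '' d) := by
  rintro _ ⟨a, ha, rfl⟩ _ ⟨b, hb, rfl⟩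
  obtain ⟨c, hc, hac, hbc⟩ := hd a ha b hb
  exact ⟨f c, ⟨c, hc, rfl⟩, hf hac, hf hbc⟩

theorem isLUB_subtype_of_image {P : X → Prop} {d : Set (Subtype P)} {a : Subtype P}
    (h : IsLUB (Subtype.val '' d) a.1) : IsLUB d a :=
  ⟨fun s hs => h.1 ⟨s, hs, rfl⟩, fun z hz => h.2 (by rintro _ ⟨s, hs, rfl⟩; exact hz hs)⟩

/-- Suprema in the subtype are those of the ambient order. Both completeness of the subtype and
continuity of `Subtype.val` follow from this. -/
theorem isLUB_subtype_image {P : X → Prop} (hP : DirectedClosed P) {d : Set (Subtype P)}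
    (hd : d.Nonempty) (hd' : DirectedOn (· ≤ ·) d) {a : X}
    (h : IsLUB (Subtype.val '' d) a) : ∃ h' : P a, IsLUB d ⟨a, h'⟩ := by
  have h' : P a := hP _ (hd.image _) (Monotone.image_directedOn (f := Subtype.val) (fun _ _ h => h) hd')
    (by rintro _ ⟨s, _, rfl⟩; exact s.2) a h
  exact ⟨h', isLUB_subtype_of_image h⟩

theorem DirectedClosed.exists_isLUB {P : X → Prop} (hP : DirectedClosed P)
    (hX : ∀ d : Set X, d.Nonempty → DirectedOn (· ≤ ·) d → ∃ a, IsLUB d a)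
    (d : Set (Subtype P)) (hd : d.Nonempty) (hd' : DirectedOn (· ≤ ·) d) : ∃ a, IsLUB d a := by
  obtain ⟨a, ha⟩ := hX _ (hd.image _)
    (Monotone.image_directedOn (f := Subtype.val) (fun _ _ h => h) hd')
  exact ⟨_, (isLUB_subtype_image hP hd hd' ha).2⟩

theorem DirectedClosed.scottContinuous_val {P : X → Prop} (hP : DirectedClosed P)
    (hX : ∀ d : Set X, d.Nonempty → DirectedOn (· ≤ ·) d → ∃ a, IsLUB d a) :
    ScottContinuous (Subtype.val : Subtype P → X) := by
  intro d hd hd' a ha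
  obtain ⟨b, hb⟩ := hX _ (hd.image _)
    (Monotone.image_directedOn (f := Subtype.val) (fun _ _ h => h) hd')
  rw [ha.unique (isLUB_subtype_image hP hd hd' hb).2]
  exact hb

theorem ScottContinuous.subtype_mk {P : X → Prop} {f : Y → Subtype P}
    (hf : ScottContinuous fun y => (f y).1) : ScottContinuous f := by
  intro d hd hd' a ha
  refine isLUB_subtype_of_image ?_
  rw [← Set.image_comp]
  exact hf hd hd' ha

theorem exists_isLUB_pi (hX : ∀ d : Set X, d.Nonempty → DirectedOn (· ≤ ·) d → ∃ a, IsLUB d a)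
    (d : Set (ι → X)) (hd : d.Nonempty) (hd' : DirectedOn (· ≤ ·) d) : ∃ a, IsLUB d a := by
  have (i : ι) : ∃ a, IsLUB (Function.eval i '' d) a :=
    hX _ (hd.image _) ((Function.monotone_eval i).image_directedOn hd')
  choose a ha using this
  exact ⟨a, isLUB_pi.2 ha⟩

theorem ScottContinuous.eval (i : ι) : ScottContinuous fun f : ι → X => f i :=
  fun _ _ _ _ ha => isLUB_pi.1 ha i

theorem ScottContinuous.pi {f : Y → ι → X} (hf : ∀ i, ScottContinuous fun y => f y i) :
    ScottContinuous f := by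
  intro d hd hd' a ha
  refine isLUB_pi.2 fun i => ?_
  rw [← Set.image_comp]
  exact hf i hd hd' ha

/-- Two suprema are interchanged: one over the functions in `d`, the other over the points in `e`.
-/
theorem directedClosed_scottContinuous :
    DirectedClosed (ScottContinuous : (Y → X) → Prop) := by
  intro d _ _ h f hf e he he' x hx
  have hmono : Monotone f := fun y y' hy => (isLUB_pi.1 hf y).2 (by
    rintro _ ⟨g, hg, rfl⟩
    exact ((h g hg).monotone hy).trans ((isLUB_pi.1 hf y').1 ⟨g, hg, rfl⟩))
  refine ⟨?_, fun z hz => (isLUB_pi.1 hf x).2 ?_⟩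
  · rintro _ ⟨y, hy, rfl⟩
    exact hmono (hx.1 hy)
  · rintro _ ⟨g, hg, rfl⟩
    refine (h g hg he he' hx).2 ?_
    rintro _ ⟨y, hy, rfl⟩
    exact ((isLUB_pi.1 hf y).1 ⟨g, hg, rfl⟩).trans (hz ⟨y, hy, rfl⟩)

theorem directedClosed_eq_bot [OrderBot X] (i : ι) :
    DirectedClosed fun f : ι → X => f i = ⊥ := by
  intro d _ _ h f hf
  refine le_bot_iff.1 ((isLUB_pi.1 hf i).2 ?_)
  rintro _ ⟨g, hg, rfl⟩
  exact (h g hg).le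

theorem DirectedClosed.and {P Q : X → Prop} (hP : DirectedClosed P) (hQ : DirectedClosed Q) :
    DirectedClosed fun x => P x ∧ Q x :=
  fun d hd hd' h a ha => ⟨hP d hd hd' (fun x hx => (h x hx).1) a ha,
    hQ d hd hd' (fun x hx => (h x hx).2) a ha⟩

end Order

/-! ### Cartesian closure of dcpos. -/

namespace DCPO

/-- The dcpo of Scott-continuous functions, ordered pointwise. -/
def exponential (X Y : DCPO.{u}) : DCPO.{u} :=
  ⟨{f : X → Y // ScottContinuous f},
    directedClosed_scottContinuous.exists_isLUB (exists_isLUB_pi Y.exists_isLUB)⟩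

/-- Separate continuity implies joint continuity. In the function variable it holds because suprema
of functions are pointwise. -/
theorem exponential_eval_scott {X Y : DCPO.{u}} :
    ScottContinuous fun p : X × exponential X Y => p.2.1 p.1 :=
  ScottContinuous.fromProd (fun x =>
      (directedClosed_scottContinuous.scottContinuous_val
        (exists_isLUB_pi Y.exists_isLUB)).comp (ScottContinuous.eval x))
    (fun f => f.2)

theorem scott_prodMk_left {X Y : Type*} [PartialOrder X] [PartialOrder Y] (x : X) :
    ScottContinuous fun y : Y => (x, y) :=
  ScottContinuous.prodMk (ScottContinuous.const x) ScottContinuous.id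

theorem scott_prodMk_right {X Y : Type*} [PartialOrder X] [PartialOrder Y] (y : Y) :
    ScottContinuous fun x : X => (x, y) :=
  ScottContinuous.prodMk ScottContinuous.id (ScottContinuous.const y)

/-- Currying of Scott-continuous functions. -/
def curryEquiv (X Y Z : DCPO.{u}) : (X ⊗ Y ⟶ Z) ≃ (Y ⟶ exponential X Z) where
  toFun f := ⟨fun y => ⟨fun x => f.toFun (x, y), (scott_prodMk_right y).comp f.scott⟩,
    .subtype_mk (.pi fun x => (scott_prodMk_left x).comp f.scott)⟩
  invFun g := ⟨fun p : X × Y => (g.toFun p.2).1 p.1,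
    (ScottContinuous.prodMk ScottContinuous.fst
      (ScottContinuous.snd.comp g.scott)).comp exponential_eval_scott⟩
  left_inv _ := rfl
  right_inv _ := rfl

/-- Dcpos form a cartesian closed category. -/
@[reducible]
def monoidalClosed : MonoidalClosed DCPO.{u} where
  closed X :=
    { rightAdj := _
      adj := Adjunction.adjunctionOfEquivRight (F := tensorLeft X) (curryEquiv X)
        (fun _ _ _ _ _ => rfl) }

/-! ### Finite coproducts of dcpos. -/

/-- The empty dcpo. -/
def empty : DCPO.{u} := ⟨PEmpty, fun _ ⟨x, _⟩ _ => x.elim⟩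

/-- Elements of different summands are incomparable, so an upper bound in one summand forces the
whole set into it. -/
theorem sum_inl_isLUB {X Y : Type*} [PartialOrder X] [PartialOrder Y] {d : Set (X ⊕ Y)}
    {x : X} (h : IsLUB d (Sum.inl x)) (hd : d.Nonempty) :
    ∃ e : Set X, d = Sum.inl '' e ∧ e.Nonempty ∧ IsLUB e x := by
  have key : d = Sum.inl '' (Sum.inl ⁻¹' d) := by
    ext y
    refine ⟨fun hy => ?_, by rintro ⟨w, hw, rfl⟩; exact hw⟩
    cases y with
    | inl y => exact ⟨y, hy, rfl⟩
    | inr y => exact absurd (h.1 hy) Sum.not_inr_le_inl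
  refine ⟨_, key, by rw [key] at hd; exact hd.of_image, fun y hy => Sum.inl_le_inl_iff.1 (h.1 hy),
    fun z hz => Sum.inl_le_inl_iff.1 (h.2 ?_)⟩
  rw [key]
  rintro _ ⟨y, hy, rfl⟩
  exact Sum.inl_le_inl_iff.2 (hz hy)

theorem sum_inr_isLUB {X Y : Type*} [PartialOrder X] [PartialOrder Y] {d : Set (X ⊕ Y)}
    {y : Y} (h : IsLUB d (Sum.inr y)) (hd : d.Nonempty) :
    ∃ e : Set Y, d = Sum.inr '' e ∧ e.Nonempty ∧ IsLUB e y := by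
  have key : d = Sum.inr '' (Sum.inr ⁻¹' d) := by
    ext x
    refine ⟨fun hx => ?_, by rintro ⟨w, hw, rfl⟩; exact hw⟩
    cases x with
    | inr x => exact ⟨x, hx, rfl⟩
    | inl x => exact absurd (h.1 hx) Sum.not_inl_le_inr
  refine ⟨_, key, by rw [key] at hd; exact hd.of_image, fun y hy => Sum.inr_le_inr_iff.1 (h.1 hy),
    fun z hz => Sum.inr_le_inr_iff.1 (h.2 ?_)⟩
  rw [key]
  rintro _ ⟨y, hy, rfl⟩
  exact Sum.inr_le_inr_iff.2 (hz hy)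

theorem inl_scott {X Y : Type*} [PartialOrder X] [PartialOrder Y] :
    ScottContinuous (Sum.inl : X → X ⊕ Y) := by
  intro d hd _ a ha
  refine ⟨by rintro _ ⟨y, hy, rfl⟩; exact Sum.inl_le_inl_iff.2 (ha.1 hy), fun z hz => ?_⟩
  cases z with
  | inl z =>
    exact Sum.inl_le_inl_iff.2 (ha.2 fun y hy => Sum.inl_le_inl_iff.1 (hz ⟨y, hy, rfl⟩))
  -- An element of `d` rules out upper bounds in the other summand; every `inr z` would bound the
  -- empty set.
  | inr z => exact absurd (hz ⟨_, hd.some_mem, rfl⟩) Sum.not_inl_le_inr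

theorem inr_scott {X Y : Type*} [PartialOrder X] [PartialOrder Y] :
    ScottContinuous (Sum.inr : Y → X ⊕ Y) := by
  intro d hd _ a ha
  refine ⟨by rintro _ ⟨y, hy, rfl⟩; exact Sum.inr_le_inr_iff.2 (ha.1 hy), fun z hz => ?_⟩
  cases z with
  | inr z =>
    exact Sum.inr_le_inr_iff.2 (ha.2 fun y hy => Sum.inr_le_inr_iff.1 (hz ⟨y, hy, rfl⟩))
  | inl z => exact absurd (hz ⟨_, hd.some_mem, rfl⟩) Sum.not_inr_le_inl

theorem directedOn_inl {X Y : Type*} [PartialOrder X] [PartialOrder Y] {e : Set X}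
    (h : DirectedOn (· ≤ ·) ((Sum.inl : X → X ⊕ Y) '' e)) : DirectedOn (· ≤ ·) e := by
  intro a ha b hb
  obtain ⟨_, ⟨c, hc, rfl⟩, hac, hbc⟩ := h _ ⟨a, ha, rfl⟩ _ ⟨b, hb, rfl⟩
  exact ⟨c, hc, Sum.inl_le_inl_iff.1 hac, Sum.inl_le_inl_iff.1 hbc⟩

theorem directedOn_inr {X Y : Type*} [PartialOrder X] [PartialOrder Y] {e : Set Y}
    (h : DirectedOn (· ≤ ·) ((Sum.inr : Y → X ⊕ Y) '' e)) : DirectedOn (· ≤ ·) e := by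
  intro a ha b hb
  obtain ⟨_, ⟨c, hc, rfl⟩, hac, hbc⟩ := h _ ⟨a, ha, rfl⟩ _ ⟨b, hb, rfl⟩
  exact ⟨c, hc, Sum.inr_le_inr_iff.1 hac, Sum.inr_le_inr_iff.1 hbc⟩

/-- Elements of different summands have no common upper bound, so a directed set lies in the summand
of any one of its members. -/
theorem sum_exists_isLUB {X Y : DCPO.{u}} (d : Set (X ⊕ Y)) (hd : d.Nonempty)
    (hd' : DirectedOn (· ≤ ·) d) : ∃ a, IsLUB d a := by
  obtain ⟨w, hw⟩ := hd
  cases w with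
  | inl w =>
    have key : d = Sum.inl '' (Sum.inl ⁻¹' d) := by
      ext y
      refine ⟨fun hy => ?_, by rintro ⟨w, hw, rfl⟩; exact hw⟩
      cases y with
      | inl y => exact ⟨y, hy, rfl⟩
      | inr y =>
        obtain ⟨c | c, _, h₁, h₂⟩ := hd' _ hw _ hy
        · exact absurd h₂ Sum.not_inr_le_inl
        · exact absurd h₁ Sum.not_inl_le_inr
    have hdir : DirectedOn (· ≤ ·) (Sum.inl ⁻¹' d : Set X) := directedOn_inl (key ▸ hd')
    obtain ⟨a, ha⟩ := X.exists_isLUB _ ⟨w, hw⟩ hdir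
    rw [key]
    exact ⟨_, inl_scott ⟨w, hw⟩ hdir ha⟩
  | inr w =>
    have key : d = Sum.inr '' (Sum.inr ⁻¹' d) := by
      ext y
      refine ⟨fun hy => ?_, by rintro ⟨w, hw, rfl⟩; exact hw⟩
      cases y with
      | inr y => exact ⟨y, hy, rfl⟩
      | inl y =>
        obtain ⟨c | c, _, h₁, h₂⟩ := hd' _ hw _ hy
        · exact absurd h₁ Sum.not_inr_le_inl
        · exact absurd h₂ Sum.not_inl_le_inr
    have hdir : DirectedOn (· ≤ ·) (Sum.inr ⁻¹' d : Set Y) := directedOn_inr (key ▸ hd')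
    obtain ⟨a, ha⟩ := Y.exists_isLUB _ ⟨w, hw⟩ hdir
    rw [key]
    exact ⟨_, inr_scott ⟨w, hw⟩ hdir ha⟩

/-- The disjoint sum of dcpos. -/
def sum (X Y : DCPO.{u}) : DCPO.{u} := ⟨X ⊕ Y, sum_exists_isLUB⟩

theorem sum_elim_scott {X Y Z : Type*} [PartialOrder X] [PartialOrder Y] [PartialOrder Z]
    {f : X → Z} {g : Y → Z} (hf : ScottContinuous f) (hg : ScottContinuous g) :
    ScottContinuous (Sum.elim f g) := by
  intro d hd hd' a ha
  cases a with
  | inl a =>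
    obtain ⟨e, rfl, he, hl⟩ := sum_inl_isLUB ha hd
    rw [← Set.image_comp]
    exact hf he (directedOn_inl hd') hl
  | inr a =>
    obtain ⟨e, rfl, he, hl⟩ := sum_inr_isLUB ha hd
    rw [← Set.image_comp]
    exact hg he (directedOn_inr hd') hl

theorem hasFiniteCoproducts : HasFiniteCoproducts DCPO.{u} := by
  have : HasInitial DCPO.{u} := IsInitial.hasInitial (X := empty)
    (IsInitial.ofUniqueHom (fun _ => ⟨fun x => PEmpty.elim x, fun _ ⟨x, _⟩ => PEmpty.elim x⟩)
      (fun _ _ => hom_ext' fun x => PEmpty.elim x))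
  have (X Y : DCPO.{u}) : HasColimit (pair X Y) :=
    ⟨⟨BinaryCofan.mk (P := sum X Y) ⟨Sum.inl, inl_scott⟩ ⟨Sum.inr, inr_scott⟩,
      BinaryCofan.IsColimit.mk _
        (fun f g => ⟨Sum.elim f.toFun g.toFun, sum_elim_scott f.scott g.scott⟩)
        (fun _ _ => rfl) (fun _ _ => rfl)
        (fun f g m h₁ h₂ => hom_ext' fun x => by
          subst h₁ h₂
          change X ⊕ Y at x
          cases x <;> rfl)⟩⟩
  have : HasBinaryCoproducts DCPO.{u} := hasBinaryCoproducts_of_hasColimit_pair _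
  exact hasFiniteCoproducts_of_has_binary_and_initial

end DCPO

namespace PointedDCPO

/-! ### Strict function spaces -/

theorem directedClosed_strictHom (A B : PointedDCPO.{u}) :
    DirectedClosed fun f : A → B => ScottContinuous f ∧ f ⊥ = ⊥ :=
  directedClosed_scottContinuous.and (directedClosed_eq_bot ⊥)

/-- The pointed dcpo of strict Scott-continuous functions, ordered pointwise. -/
def strictHom (A B : PointedDCPO.{u}) : PointedDCPO.{u} where
  toDCPO := ⟨{f : A → B // ScottContinuous f ∧ f ⊥ = ⊥},
    (directedClosed_strictHom A B).exists_isLUB (exists_isLUB_pi B.toDCPO.exists_isLUB)⟩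
  bot := { bot := (⟨fun _ => ⊥, ScottContinuous.const _, rfl⟩ :
            {f : A → B // ScottContinuous f ∧ f ⊥ = ⊥})
           bot_le := fun _ _ => bot_le }

theorem strictHom_apply_scott {A B : PointedDCPO.{u}} (a : A) :
    ScottContinuous fun f : strictHom A B => f.1 a :=
  ((directedClosed_strictHom A B).scottContinuous_val
    (exists_isLUB_pi B.toDCPO.exists_isLUB)).comp (ScottContinuous.eval a)

theorem strictHom_eval_scott {A B : PointedDCPO.{u}} :
    ScottContinuous fun p : A × strictHom A B => p.2.1 p.1 :=
  ScottContinuous.fromProd strictHom_apply_scott (fun f => f.2.1)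

theorem pair_left_scott {A B : PointedDCPO.{u}} (a : A) :
    ScottContinuous fun b : B => (pair a b : smash A B) :=
  (DCPO.scott_prodMk_left a).comp pair_scott

theorem pair_right_scott {A B : PointedDCPO.{u}} (b : B) :
    ScottContinuous fun a : A => (pair a b : smash A B) :=
  (DCPO.scott_prodMk_right b).comp pair_scott

/-- Currying of strict Scott-continuous functions. -/
noncomputable def curryEquiv (A B C : PointedDCPO.{u}) :
    (smash A B ⟶ C) ≃ (B ⟶ strictHom A C) where
  toFun f :=
    { toFun := fun b => ⟨fun a => f.toFun (pair a b), (pair_right_scott b).comp f.scott,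
        by change f.toFun (pair ⊥ b) = ⊥; rw [pair_bot_left, f.strict]⟩
      scott := .subtype_mk (.pi fun a => (pair_left_scott a).comp f.scott)
      strict := Subtype.ext (funext fun a => by
        change f.toFun (pair a ⊥) = ⊥
        rw [pair_bot_right, f.strict]) }
  invFun g := smashDesc (fun p : A × B => (g.toFun p.2).1 p.1)
    ((ScottContinuous.prodMk ScottContinuous.fst
      (ScottContinuous.snd.comp g.scott)).comp strictHom_eval_scott) (g.toFun ⊥).2.2
  left_inv f := smash_hom_ext fun a b =>
    smashDesc_pair _ _ (fun b => by change f.toFun (pair ⊥ b) = ⊥; rw [pair_bot_left, f.strict])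
      (fun a => by change f.toFun (pair a ⊥) = ⊥; rw [pair_bot_right, f.strict]) a b
  right_inv g := hom_ext' fun b => Subtype.ext (funext fun a =>
    smashDesc_pair (fun p : A × B => (g.toFun p.2).1 p.1)
      ((ScottContinuous.prodMk ScottContinuous.fst
        (ScottContinuous.snd.comp g.scott)).comp strictHom_eval_scott) (fun b => (g.toFun b).2.2)
      (fun a => congrArg (fun k : strictHom A C => k.1 a) g.strict) a b)

/-- Pointed dcpos form a symmetric monoidal closed category for the smash product. -/
@[reducible]
noncomputable def monoidalClosed : MonoidalClosed PointedDCPO.{u} where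
  closed A :=
    { rightAdj := _
      adj := Adjunction.adjunctionOfEquivRight (F := tensorLeft A) (curryEquiv A)
        (fun _ _ _ f g => hom_ext' fun b => Subtype.ext (funext fun a =>
          congrArg g.toFun (smashMap_pair (𝟙 A) f a b))) }

/-! ### Coalesced sums -/

/-- The coalesced sum of two pointed dcpos, as the set of the pairs with an entry equal to the
least element. -/
abbrev CoalescedSum (A B : PointedDCPO.{u}) : Type u :=
  {p : A × B // p.1 = ⊥ ∨ p.2 = ⊥}

/-- A common upper bound of a pair with non-bottom first entry and one with non-bottom second entry
would leave both axes. Thus a directed set stays on one axis, which reduces the coalesced sum to its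
summands. -/
theorem forall_fst_or_snd_eq_bot {A B : PointedDCPO.{u}} {d : Set (A × B)}
    (hd : DirectedOn (· ≤ ·) d) (h : ∀ p ∈ d, p.1 = ⊥ ∨ p.2 = ⊥) :
    (∀ p ∈ d, p.1 = ⊥) ∨ ∀ p ∈ d, p.2 = ⊥ := by
  by_contra! hne
  obtain ⟨⟨p, hp, hp'⟩, q, hq, hq'⟩ := hne
  obtain ⟨r, hr, hpr, hqr⟩ := hd p hp q hq
  rcases h r hr with h | h
  · exact hp' (le_bot_iff.1 (h ▸ hpr.1))
  · exact hq' (le_bot_iff.1 (h ▸ hqr.2))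

theorem isLUB_eq_bot {A : PointedDCPO.{u}} {d : Set A} {a : A} (h : IsLUB d a)
    (hd : ∀ x ∈ d, x = ⊥) : a = ⊥ :=
  le_bot_iff.1 (h.2 fun x hx => (hd x hx).le)

theorem directedClosed_coalescedSum (A B : PointedDCPO.{u}) :
    DirectedClosed fun p : A × B => p.1 = ⊥ ∨ p.2 = ⊥ := by
  intro d _ hd' h a ha
  have ha' := isLUB_prod.1 ha
  refine (forall_fst_or_snd_eq_bot hd' h).imp (fun h => isLUB_eq_bot ha'.1 ?_)
    (fun h => isLUB_eq_bot ha'.2 ?_)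
  all_goals
    rintro _ ⟨p, hp, rfl⟩
    exact h p hp

/-- The coalesced sum as a pointed dcpo. -/
def coalescedSum (A B : PointedDCPO.{u}) : PointedDCPO.{u} where
  toDCPO := ⟨CoalescedSum A B,
    (directedClosed_coalescedSum A B).exists_isLUB DCPO.exists_isLUB_prod⟩
  bot := { bot := (⟨(⊥, ⊥), by simp⟩ : CoalescedSum A B)
           bot_le := fun _ => ⟨bot_le, bot_le⟩ }

theorem coalescedSum_val_scott {A B : PointedDCPO.{u}} :
    ScottContinuous (Subtype.val : CoalescedSum A B → A × B) :=
  (directedClosed_coalescedSum A B).scottContinuous_val DCPO.exists_isLUB_prod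

/-- The left inclusion into the coalesced sum. -/
def coalescedInl (A B : PointedDCPO.{u}) : A ⟶ coalescedSum A B where
  toFun a := (⟨(a, ⊥), Or.inr rfl⟩ : CoalescedSum A B)
  scott := .subtype_mk (DCPO.scott_prodMk_right _)
  strict := rfl

/-- The right inclusion into the coalesced sum. -/
def coalescedInr (A B : PointedDCPO.{u}) : B ⟶ coalescedSum A B where
  toFun b := (⟨(⊥, b), Or.inl rfl⟩ : CoalescedSum A B)
  scott := .subtype_mk (DCPO.scott_prodMk_left _)
  strict := rfl

theorem coalescedSum_cases {A B : PointedDCPO.{u}} {P : coalescedSum A B → Prop}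
    (hl : ∀ a, P ((coalescedInl A B).toFun a)) (hr : ∀ b, P ((coalescedInr A B).toFun b))
    (s : coalescedSum A B) : P s := by
  obtain ⟨⟨a, b⟩, h | h⟩ := s
  · obtain rfl : a = ⊥ := h
    exact hr b
  · obtain rfl : b = ⊥ := h
    exact hl a

-- A directed set and its supremum lie on one axis, and there the function is `f` or `g` after a
-- projection.
open Classical in
theorem coalescedDesc_scott {A B C : PointedDCPO.{u}} (f : A ⟶ C) (g : B ⟶ C) :
    ScottContinuous fun s : CoalescedSum A B =>
      if s.1.2 = ⊥ then f.toFun s.1.1 else g.toFun s.1.2 := by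
  -- The branches agree at `(⊥, ⊥)` since `f` and `g` are strict, so the second formula is valid on
  -- its whole axis.
  have hr (s : CoalescedSum A B) (hs : s.1.1 = ⊥) :
      (if s.1.2 = ⊥ then f.toFun s.1.1 else g.toFun s.1.2) = g.toFun s.1.2 := by
    split_ifs with h
    · rw [hs, h, f.strict, g.strict]
    · rfl
  intro d hd hd' a ha
  have ha' := isLUB_prod.1 (coalescedSum_val_scott hd hd' ha)
  have hval : DirectedOn (· ≤ ·) ((Subtype.val : CoalescedSum A B → A × B) '' d) :=
    Monotone.image_directedOn (f := Subtype.val) (fun _ _ h => h) hd'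
  beta_reduce
  rcases forall_fst_or_snd_eq_bot hval (by rintro _ ⟨s, _, rfl⟩; exact s.2) with h | h
  · have h₀ : a.1.1 = ⊥ := isLUB_eq_bot ha'.1 (by rintro _ ⟨p, hp, rfl⟩; exact h p hp)
    rw [hr a h₀, Set.image_congr fun s hs => hr s (h _ ⟨s, hs, rfl⟩)]
    exact (coalescedSum_val_scott.comp (ScottContinuous.snd.comp g.scott)) hd hd' ha
  · have h₀ : a.1.2 = ⊥ := isLUB_eq_bot ha'.2 (by rintro _ ⟨p, hp, rfl⟩; exact h p hp)
    rw [if_pos h₀, Set.image_congr fun s hs => if_pos (h _ ⟨s, hs, rfl⟩)]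
    exact (coalescedSum_val_scott.comp (ScottContinuous.fst.comp f.scott)) hd hd' ha

open Classical in
/-- The strict map out of the coalesced sum given by two strict maps. -/
noncomputable def coalescedDesc {A B C : PointedDCPO.{u}} (f : A ⟶ C) (g : B ⟶ C) :
    coalescedSum A B ⟶ C where
  toFun (s : CoalescedSum A B) := if s.1.2 = ⊥ then f.toFun s.1.1 else g.toFun s.1.2
  strict := (if_pos rfl).trans f.strict
  scott := coalescedDesc_scott f g

theorem coalescedInl_desc {A B C : PointedDCPO.{u}} (f : A ⟶ C) (g : B ⟶ C) (a : A) :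
    (coalescedDesc f g).toFun ((coalescedInl A B).toFun a) = f.toFun a :=
  if_pos rfl

theorem coalescedInr_desc {A B C : PointedDCPO.{u}} (f : A ⟶ C) (g : B ⟶ C) (b : B) :
    (coalescedDesc f g).toFun ((coalescedInr A B).toFun b) = g.toFun b := by
  by_cases hb : b = ⊥
  · subst hb
    exact (if_pos rfl).trans (f.strict.trans g.strict.symm)
  · exact if_neg hb

/-- The one-point pointed dcpo. -/
def point : PointedDCPO.{u} where
  toDCPO := DCPO.one
  bot := inferInstanceAs (OrderBot PUnit)

theorem hasFiniteCoproducts : HasFiniteCoproducts PointedDCPO.{u} := by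
  have : HasInitial PointedDCPO.{u} := IsInitial.hasInitial (X := point)
    (IsInitial.ofUniqueHom (fun _ => ⟨fun _ => ⊥, ScottContinuous.const _, rfl⟩)
      (fun _ m => hom_ext' fun _ => m.strict))
  have (A B : PointedDCPO.{u}) : HasColimit (Limits.pair A B) :=
    ⟨⟨BinaryCofan.mk (coalescedInl A B) (coalescedInr A B),
      BinaryCofan.IsColimit.mk _ (fun f g => coalescedDesc f g)
        (fun f g => hom_ext' (coalescedInl_desc f g))
        (fun f g => hom_ext' (coalescedInr_desc f g))
        (fun f g m h₁ h₂ => by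
          subst h₁ h₂
          exact hom_ext' (coalescedSum_cases
            (fun a => (coalescedInl_desc (coalescedInl A B ≫ m) (coalescedInr A B ≫ m) a).symm)
            (fun b => (coalescedInr_desc (coalescedInl A B ≫ m) (coalescedInr A B ≫ m) b).symm)))⟩⟩
  have : HasBinaryCoproducts PointedDCPO.{u} := hasBinaryCoproducts_of_hasColimit_pair _
  exact hasFiniteCoproducts_of_has_binary_and_initial

/-! ### The symmetric monoidal adjunction -/

theorem curryEquiv_symm_pair {A B C : PointedDCPO.{u}} (g : B ⟶ strictHom A C) (a : A) (b : B) :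
    ((curryEquiv A B C).symm g).toFun (pair a b) = (g.toFun b).1 a :=
  congrArg (fun k : B ⟶ strictHom A C => (k.toFun b).1 a) ((curryEquiv A B C).apply_symm_apply g)

/-- The element of `X_⊥` given by an element of `X`. -/
def lifted {X : DCPO.{u}} (x : X) : liftObj X := (x : WithBot X)

theorem lifted_scott {X : DCPO.{u}} : ScottContinuous (lifted : X → liftObj X) :=
  (up X).scott

/-- The strict map out of `A ⊗ X_⊥` given by a Scott-continuous function on `A × X` that is strict
in its first argument. -/
noncomputable def bangDesc {A B : PointedDCPO.{u}} {X : DCPO.{u}} (f : A × X → B)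
    (hf : ScottContinuous f) (h : ∀ x, f (⊥, x) = ⊥) : smash A (liftObj X) ⟶ B :=
  -- A continuous map from `X` to the strict function space extends to `X_⊥` and is then uncurried,
  -- so continuity on the smash product needs no separate check.
  (curryEquiv A (liftObj X) B).symm (extend
    ⟨fun x => ⟨fun a => f (a, x), (DCPO.scott_prodMk_right x).comp hf, h x⟩,
      .subtype_mk (.pi fun a => (DCPO.scott_prodMk_left a).comp hf)⟩)

theorem bangDesc_pair {A B : PointedDCPO.{u}} {X : DCPO.{u}} (f : A × X → B)
    (hf : ScottContinuous f) (h : ∀ x, f (⊥, x) = ⊥) (a : A) (x : X) :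
    (bangDesc f hf h).toFun (pair a (lifted x)) = f (a, x) :=
  curryEquiv_symm_pair _ _ _

theorem lift_cases {X : DCPO.{u}} {P : liftObj X → Prop} (hbot : P ⊥)
    (hup : ∀ x, P (lifted x)) (t : liftObj X) : P t := by
  change WithBot X at t
  cases t with
  | bot => exact hbot
  | coe x => exact hup x

/-- The remaining pairs have second entry `⊥`, where strictness decides. -/
theorem bang_hom_ext {A B : PointedDCPO.{u}} {X : DCPO.{u}} {f g : smash A (liftObj X) ⟶ B}
    (h : ∀ a x, f.toFun (pair a (lifted x)) = g.toFun (pair a (lifted x))) :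
    f = g :=
  smash_hom_ext fun a => lift_cases (by rw [pair_bot_right, f.strict, g.strict]) (h a)

theorem smash_lift_hom_ext {B : PointedDCPO.{u}} {X Y : DCPO.{u}}
    {f g : smash (liftObj X) (liftObj Y) ⟶ B}
    (h : ∀ x y, f.toFun (pair (lifted x) (lifted y)) =
      g.toFun (pair (lifted x) (lifted y))) : f = g :=
  bang_hom_ext fun a y => lift_cases
    (P := fun a => f.toFun (pair a (lifted y)) = g.toFun (pair a (lifted y)))
    (by rw [pair_bot_left, f.strict, g.strict]) (fun x => h x y) a

theorem smash_lift_hom_ext₃ {B : PointedDCPO.{u}} {X Y Z : DCPO.{u}}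
    {f g : smash (smash (liftObj X) (liftObj Y)) (liftObj Z) ⟶ B}
    (h : ∀ x y z, f.toFun (pair (pair (lifted x) (lifted y)) (lifted z)) =
      g.toFun (pair (pair (lifted x) (lifted y)) (lifted z))) : f = g :=
  smash_hom_ext₃ fun a b c => by
    revert c b a
    refine lift_cases (fun b c => ?_) fun x => lift_cases (fun c => ?_) fun y =>
      lift_cases ?_ fun z => h x y z
    · rw [pair_bot_left, pair_bot_left, f.strict, g.strict]
    · rw [pair_bot_right, pair_bot_left, f.strict, g.strict]
    · rw [pair_bot_right, f.strict, g.strict]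

/-- The action of the lifting functor on morphisms. -/
abbrev liftMap {X Y : DCPO.{u}} (f : X ⟶ Y) : liftObj X ⟶ liftObj Y := lifting.map f

theorem liftMap_lifted {X Y : DCPO.{u}} (f : X ⟶ Y) (x : X) :
    (liftMap f).toFun (lifted x) = lifted (f.toFun x) := rfl

/-- The pairs of elements as elements of the product of dcpos. -/
def prodMk {X Y : DCPO.{u}} (x : X) (y : Y) : (X ⊗ Y : DCPO.{u}) := (x, y)

/-- The comparison map `X_⊥ ⊗ Y_⊥ ⟶ (X × Y)_⊥`. -/
noncomputable def liftTensor (X Y : DCPO.{u}) : smash (liftObj X) (liftObj Y) ⟶ liftObj (X ⊗ Y) :=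
  (curryEquiv (liftObj X) (liftObj Y) (liftObj (X ⊗ Y))).symm (extend
    ⟨fun y =>
      have k : liftObj X ⟶ liftObj (X ⊗ Y) := extend
        ⟨fun x => lifted (prodMk x y), (DCPO.scott_prodMk_right y).comp (lifted_scott (X := X ⊗ Y))⟩
      ⟨k.toFun, k.scott, k.strict⟩,
      -- Continuity in `y` is checked at each fixed first argument: at `⊥` the value is constantly
      -- `⊥`, and at a lifted `x` it is the lifting of `(x, y)`.
      .subtype_mk (.pi (lift_cases (ScottContinuous.const ⊥)
        fun x => (DCPO.scott_prodMk_left x).comp (lifted_scott (X := X ⊗ Y))))⟩)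

theorem liftTensor_pair {X Y : DCPO.{u}} (x : X) (y : Y) :
    (liftTensor X Y).toFun (pair (lifted x) (lifted y)) =
      lifted (prodMk x y) :=
  curryEquiv_symm_pair _ _ _

/-- The lifting functor is lax symmetric monoidal. -/
@[reducible]
noncomputable def liftingLaxBraided : lifting.{u}.LaxBraided where
  -- The smash unit is by definition the lifting of the one-point dcpo.
  ε := 𝟙 sierpinski
  μ := liftTensor
  μ_natural_left {X Y} f Z := smash_lift_hom_ext fun x z => by
    change (liftTensor Y Z).toFun ((smashMap (liftMap f) (𝟙 (liftObj Z))).toFun _) =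
      (liftMap (f ▷ Z)).toFun ((liftTensor X Z).toFun _)
    rw [smashMap_pair, id_toFun, liftMap_lifted, liftTensor_pair, liftTensor_pair,
      liftMap_lifted]
    rfl
  μ_natural_right {X Y} Z f := smash_lift_hom_ext fun z x => by
    change (liftTensor Z Y).toFun ((smashMap (𝟙 (liftObj Z)) (liftMap f)).toFun _) =
      (liftMap (Z ◁ f)).toFun ((liftTensor Z X).toFun _)
    rw [smashMap_pair, id_toFun, liftMap_lifted, liftTensor_pair, liftTensor_pair,
      liftMap_lifted]
    rfl
  associativity X Y Z := smash_lift_hom_ext₃ fun x y z => by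
    change (liftMap (α_ X Y Z).hom).toFun ((liftTensor (X ⊗ Y) Z).toFun
        ((smashMap (liftTensor X Y) (𝟙 (liftObj Z))).toFun _)) =
      (liftTensor X (Y ⊗ Z)).toFun ((smashMap (𝟙 (liftObj X)) (liftTensor Y Z)).toFun
        ((smashAssoc (liftObj X) (liftObj Y) (liftObj Z)).toFun _))
    rw [smashMap_pair, id_toFun, smashAssoc_pair, smashMap_pair, id_toFun, liftTensor_pair,
      liftTensor_pair, liftTensor_pair, liftTensor_pair, liftMap_lifted]
    rfl
  -- Only the pairs `(⊤, a)` matter, and `⊤` is itself the lifted point of `DCPO.one`, so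
  -- `liftTensor_pair` applies once `a` is lifted too.
  left_unitality X := smashLeft_hom_ext (A := liftObj X) fun a => by
    revert a
    refine lift_cases (by rw [pair_bot_right (B := liftObj X)]; exact (Hom.strict _).trans (Hom.strict _).symm)
      fun x => ?_
    change (smashLeft (liftObj X)).toFun _ = (liftMap (λ_ X).hom).toFun
      ((liftTensor DCPO.one X).toFun ((smashMap (𝟙 sierpinski) (𝟙 (liftObj X))).toFun _))
    rw [smashMap_pair, smashLeft_pair, id_toFun, id_toFun]
    exact (congrArg (liftMap (λ_ X).hom).toFun
      (liftTensor_pair (X := DCPO.one) (PUnit.unit : PUnit.{u + 1}) x)).symm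
  right_unitality X := smashRight_hom_ext (A := liftObj X) fun a => by
    revert a
    refine lift_cases (by rw [pair_bot_left]; exact (Hom.strict _).trans (Hom.strict _).symm)
      fun x => ?_
    change (smashRight (liftObj X)).toFun _ = (liftMap (ρ_ X).hom).toFun
      ((liftTensor X DCPO.one).toFun ((smashMap (𝟙 (liftObj X)) (𝟙 sierpinski)).toFun _))
    rw [smashMap_pair, smashRight_pair, id_toFun, id_toFun]
    exact (congrArg (liftMap (ρ_ X).hom).toFun
      (liftTensor_pair (Y := DCPO.one) x (PUnit.unit : PUnit.{u + 1}))).symm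
  braided X Y := smash_lift_hom_ext fun x y => by
    change (liftMap (β_ X Y).hom).toFun ((liftTensor X Y).toFun _) =
      (liftTensor Y X).toFun ((smashSwap (liftObj X) (liftObj Y)).toFun _)
    rw [smashSwap_pair, liftTensor_pair, liftTensor_pair, liftMap_lifted]
    rfl

/-- The forgetful functor is lax symmetric monoidal. -/
@[reducible]
noncomputable def forgetfulLaxBraided : forgetful.{u}.LaxBraided where
  ε := up DCPO.one
  μ A B := ⟨fun p : A × B => (pair p.1 p.2 : smash A B), pair_scott⟩
  μ_natural_left f C := DCPO.hom_ext' fun _ => (smashMap_pair f (𝟙 C) _ _).symm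
  μ_natural_right C f := DCPO.hom_ext' fun _ => (smashMap_pair (𝟙 C) f _ _).symm
  associativity _ _ _ := DCPO.hom_ext' fun _ => smashAssoc_pair _ _ _
  left_unitality _ := DCPO.hom_ext' fun _ => (smashLeft_pair _).symm
  right_unitality _ := DCPO.hom_ext' fun _ => (smashRight_pair _).symm
  braided _ _ := DCPO.hom_ext' fun _ => smashSwap_pair _ _

theorem liftingAdj_isSymmetricMonoidalAdjunction :
    IsSymmetricMonoidalAdjunction liftingAdj.{u} := by
  let := liftingLaxBraided.{u}
  let := forgetfulLaxBraided.{u}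
  refine ⟨liftingLaxBraided, forgetfulLaxBraided, ?_, ?_⟩
  · exact
      { unit := rfl
        tensor := fun X Y => DCPO.hom_ext' fun p => (liftTensor_pair p.1 p.2).symm }
  · refine
      { unit := lift_hom_ext fun _ => rfl
        tensor := fun A B => smash_lift_hom_ext fun a b => ?_ }
    -- On the generator `lifted a ⊗ lifted b` both composites evaluate to `pair a b`.
    refine (congrArg (fun t => (liftingAdj.counit.app (smash A B)).toFun
      ((liftMap (Functor.LaxMonoidal.μ (self := forgetfulLaxBraided.toLaxMonoidal)
        forgetful A B)).toFun t)) (liftTensor_pair a b)).trans ?_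
    exact (smashMap_pair (A := liftObj A.toDCPO) (B := liftObj B.toDCPO) (A' := A) (B' := B)
      (liftingAdj.counit.app A) (liftingAdj.counit.app B) (lifted a) (lifted b)).symm

/-! ### Algebraic compactness -/

/-- Strict sequences in a pointed dcpo: those that stay at the least element once they reach it. -/
abbrev StrictSeq (A : PointedDCPO.{u}) : Type u :=
  {s : ℕ → A // ∀ n, s n = ⊥ → s (n + 1) = ⊥}

/-- If the supremum is `⊥` at index `n`, so is every member of the set, hence also at `n + 1`. -/
theorem directedClosed_strictSeq (A : PointedDCPO.{u}) :
    DirectedClosed fun s : ℕ → A => ∀ n, s n = ⊥ → s (n + 1) = ⊥ := by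
  intro d _ _ h s hs n hn
  refine isLUB_eq_bot (isLUB_pi.1 hs (n + 1)) ?_
  rintro _ ⟨t, ht, rfl⟩
  exact h t ht n (le_bot_iff.1 (hn ▸ (isLUB_pi.1 hs n).1 ⟨t, ht, rfl⟩))

/-- The pointed dcpo of strict sequences, ordered pointwise. -/
def seqs (A : PointedDCPO.{u}) : PointedDCPO.{u} where
  toDCPO := ⟨StrictSeq A,
    (directedClosed_strictSeq A).exists_isLUB (exists_isLUB_pi A.toDCPO.exists_isLUB)⟩
  bot := { bot := (⟨fun _ => ⊥, fun _ _ => rfl⟩ : StrictSeq A)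
           bot_le := fun _ _ => bot_le }

theorem seqs_ext {A : PointedDCPO.{u}} {s t : seqs A} (h : ∀ n, s.1 n = t.1 n) : s = t :=
  Subtype.ext (funext h)

theorem seqs_apply_scott {A : PointedDCPO.{u}} (n : ℕ) :
    ScottContinuous fun s : seqs A => s.1 n :=
  ((directedClosed_strictSeq A).scottContinuous_val
    (exists_isLUB_pi A.toDCPO.exists_isLUB)).comp (ScottContinuous.eval n)

theorem seqs_apply_eq_bot {A : PointedDCPO.{u}} (s : seqs A) (h : s.1 0 = ⊥) (n : ℕ) :
    s.1 n = ⊥ := by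
  induction n with
  | zero => exact h
  | succ n ih => exact s.2 n ih

/-- The second entry of `a ⊗ b`: it is `b` unless `a` is the least element. -/
noncomputable def guard {A B : PointedDCPO.{u}} (a : A) (b : B) : B :=
  Subtype.val (p := fun p : A × B => p.1 = ⊥ ↔ p.2 = ⊥) (pair a b) |>.2

theorem guard_bot_left {A B : PointedDCPO.{u}} (b : B) : guard (⊥ : A) b = ⊥ := by
  rw [guard, pair_bot_left]; rfl

theorem guard_bot_right {A B : PointedDCPO.{u}} (a : A) : guard a (⊥ : B) = ⊥ := by
  rw [guard, pair_bot_right]; rfl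

theorem guard_of_ne {A B : PointedDCPO.{u}} {a : A} (ha : a ≠ ⊥) (b : B) : guard a b = b := by
  by_cases hb : b = ⊥
  · rw [hb, guard_bot_right]
  · rw [guard, pair_of_ne ha hb]

/-- Defining `guard` through `pair` makes continuity a consequence of `pair_scott`, with no case
split. -/
theorem guard_scott {A B : PointedDCPO.{u}} :
    ScottContinuous fun p : A × B => guard p.1 p.2 :=
  (pair_scott.comp smash_val_scott).comp ScottContinuous.snd

/-- The sequence with given head and tail. -/
noncomputable def seqCons {A : PointedDCPO.{u}} (a : A) (s : seqs A) : seqs A :=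
  -- Guarding the tail by the head keeps the sequence strict when `a = ⊥`; it also makes `seqCons`
  -- strict in its head.
  (⟨fun n => Nat.casesOn n a fun n => guard a (s.1 n), by
    intro n h
    cases n with
    | zero =>
      obtain rfl : a = ⊥ := h
      exact guard_bot_left _
    | succ n =>
      by_cases ha : a = ⊥
      · subst ha
        exact guard_bot_left _
      · have h : guard a (s.1 n) = ⊥ := h
        change guard a (s.1 (n + 1)) = ⊥
        rw [guard_of_ne ha] at h ⊢
        exact s.2 n h⟩ : StrictSeq A)

theorem seqCons_bot {A : PointedDCPO.{u}} (s : seqs A) : seqCons ⊥ s = ⊥ :=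
  seqs_ext (seqs_apply_eq_bot _ rfl)

theorem seqCons_scott {A : PointedDCPO.{u}} :
    ScottContinuous fun p : A × seqs A => seqCons p.1 p.2 := by
  refine .subtype_mk (.pi fun n => ?_)
  cases n with
  | zero => exact ScottContinuous.fst
  | succ n =>
    exact (ScottContinuous.prodMk ScottContinuous.fst
      (ScottContinuous.snd.comp (seqs_apply_scott n))).comp guard_scott

/-- The tail of a sequence. -/
def seqTail {A : PointedDCPO.{u}} (s : seqs A) : seqs A :=
  (⟨fun n => s.1 (n + 1), fun n => s.2 (n + 1)⟩ : StrictSeq A)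

theorem seqTail_scott {A : PointedDCPO.{u}} : ScottContinuous (seqTail : seqs A → seqs A) :=
  .subtype_mk (.pi fun n => seqs_apply_scott (n + 1))

theorem seqTail_seqCons {A : PointedDCPO.{u}} {a : A} (ha : a ≠ ⊥) (s : seqs A) :
    seqTail (seqCons a s) = s :=
  seqs_ext fun n => guard_of_ne ha (s.1 n)

theorem seqCons_head_tail {A : PointedDCPO.{u}} (s : seqs A) :
    seqCons (s.1 0) (seqTail s) = s := by
  by_cases h : s.1 0 = ⊥
  · rw [h, seqCons_bot]
    exact seqs_ext fun n => (seqs_apply_eq_bot s h n).symm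
  · refine seqs_ext fun n => ?_
    cases n with
    | zero => rfl
    | succ n => exact guard_of_ne h (s.1 (n + 1))

/-- The functor `X ↦ A ⊗ X_⊥` on morphisms. -/
noncomputable def bangMap (A : PointedDCPO.{u}) {X Y : PointedDCPO.{u}} (f : X ⟶ Y) :
    smash A (liftObj X.toDCPO) ⟶ smash A (liftObj Y.toDCPO) :=
  smashMap (𝟙 A) (liftMap (forgetful.map f))

theorem bangMap_pair {A X Y : PointedDCPO.{u}} (f : X ⟶ Y) (a : A) (x : X) :
    (bangMap A f).toFun (pair a (lifted x)) = pair a (lifted (f.toFun x)) :=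
  smashMap_pair _ _ _ _

theorem bangMap_comp {A X Y Z : PointedDCPO.{u}} (f : X ⟶ Y) (g : Y ⟶ Z) :
    bangMap A (f ≫ g) = bangMap A f ≫ bangMap A g :=
  bang_hom_ext fun a x => by
    rw [comp_toFun, bangMap_pair, bangMap_pair]
    exact (bangMap_pair g a _).symm

/-- The structure map `A ⊗ Ω_⊥ ⟶ Ω` of the strict sequences. -/
noncomputable def cons (A : PointedDCPO.{u}) : smash A (liftObj (seqs A).toDCPO) ⟶ seqs A :=
  bangDesc (fun p : A × seqs A => seqCons p.1 p.2) seqCons_scott seqCons_bot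

theorem cons_pair {A : PointedDCPO.{u}} (a : A) (s : seqs A) :
    (cons A).toFun (pair a (lifted s)) = seqCons a s :=
  bangDesc_pair (fun p : A × seqs A => seqCons p.1 p.2) seqCons_scott seqCons_bot a s

/-- The costructure map `Ω ⟶ A ⊗ Ω_⊥` of the strict sequences. -/
noncomputable def uncons (A : PointedDCPO.{u}) : seqs A ⟶ smash A (liftObj (seqs A).toDCPO) where
  toFun s := pair (s.1 0) (lifted (seqTail s))
  scott := (ScottContinuous.prodMk (seqs_apply_scott 0)
    (seqTail_scott.comp lifted_scott)).comp pair_scott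
  -- The lifted tail of the bottom sequence is not `⊥`; the head is, and that collapses the pair.
  strict := pair_bot_left _

theorem uncons_apply {A : PointedDCPO.{u}} (s : seqs A) :
    (uncons A).toFun s = pair (s.1 0) (lifted (seqTail s)) := rfl

/-- The strict sequences are a fixed point of `X ↦ A ⊗ X_⊥`. -/
noncomputable def seqsIso (A : PointedDCPO.{u}) : smash A (liftObj (seqs A).toDCPO) ≅ seqs A where
  hom := cons A
  inv := uncons A
  hom_inv_id := bang_hom_ext fun a s => by
    rw [comp_toFun, id_toFun, cons_pair, uncons_apply]
    -- For `a = ⊥` the tail `s` is lost, but both sides are then the bottom of the smash product.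
    by_cases ha : a = ⊥
    · subst ha
      exact (pair_bot_left _).trans (pair_bot_left _).symm
    · rw [seqTail_seqCons ha]
      rfl
  inv_hom_id := hom_ext' fun s => by
    rw [comp_toFun, uncons_apply, cons_pair, seqCons_head_tail]
    rfl

theorem cons_uncons (A : PointedDCPO.{u}) : cons A ≫ uncons A = 𝟙 _ := (seqsIso A).hom_inv_id

theorem uncons_cons (A : PointedDCPO.{u}) : uncons A ≫ cons A = 𝟙 _ := (seqsIso A).inv_hom_id

/-- The constant map at the least element. -/
def botHom (A B : PointedDCPO.{u}) : A ⟶ B := ⟨fun _ => ⊥, ScottContinuous.const _, rfl⟩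

/-! ### Initiality of the strict sequences. -/

section Fold

variable {A B : PointedDCPO.{u}} (b : smash A (liftObj B.toDCPO) ⟶ B)

/-- The finite approximations of the algebra map from the strict sequences. -/
noncomputable def foldApprox : ℕ → (seqs A ⟶ B)
  | 0 => botHom _ _
  | n + 1 => uncons A ≫ bangMap A (foldApprox n) ≫ b

theorem foldApprox_succ (n : ℕ) :
    foldApprox b (n + 1) = uncons A ≫ bangMap A (foldApprox b n) ≫ b := rfl

theorem foldApprox_succ_apply (n : ℕ) (s : seqs A) :
    (foldApprox b (n + 1)).toFun s =
      b.toFun (pair (s.1 0) (lifted ((foldApprox b n).toFun (seqTail s)))) := by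
  rw [foldApprox_succ, comp_toFun, comp_toFun, uncons_apply, bangMap_pair]

theorem pair_lifted_scott (a : A) :
    ScottContinuous fun x : B => (pair a (lifted x) : smash A (liftObj B.toDCPO)) :=
  lifted_scott.comp (pair_left_scott a)

theorem foldApprox_le_succ (n : ℕ) (s : seqs A) :
    (foldApprox b n).toFun s ≤ (foldApprox b (n + 1)).toFun s := by
  induction n generalizing s with
  | zero => exact bot_le
  | succ n ih =>
    rw [foldApprox_succ_apply, foldApprox_succ_apply]
    exact b.scott.monotone ((pair_lifted_scott _).monotone (ih _))

theorem foldApprox_monotone (s : seqs A) : Monotone fun n => (foldApprox b n).toFun s :=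
  monotone_nat_of_le_succ fun n => foldApprox_le_succ b n s

/-- The supremum is taken in `strictHom`, where it is pointwise, so the limit is Scott-continuous
and strict at once. -/
theorem exists_fold :
    ∃ h : seqs A ⟶ B, ∀ s, IsLUB (Set.range fun n => (foldApprox b n).toFun s) (h.toFun s) := by
  let F (n : ℕ) : strictHom (seqs A) B :=
    ⟨(foldApprox b n).toFun, (foldApprox b n).scott, (foldApprox b n).strict⟩
  have hF : Monotone F := fun m n h s => foldApprox_monotone b s h
  have hdir : DirectedOn (· ≤ ·) (Set.range F) := directedOn_range.2 hF.directed_le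
  obtain ⟨h, hh⟩ := (strictHom (seqs A) B).toDCPO.exists_isLUB _ (Set.range_nonempty F) hdir
  refine ⟨⟨h.1, h.2.1, h.2.2⟩, fun s => ?_⟩
  have := strictHom_apply_scott s (Set.range_nonempty F) hdir hh
  rwa [← Set.range_comp] at this

/-- The algebra map from the strict sequences. -/
noncomputable def fold : seqs A ⟶ B := (exists_fold b).choose

theorem fold_isLUB (s : seqs A) :
    IsLUB (Set.range fun n => (foldApprox b n).toFun s) ((fold b).toFun s) :=
  (exists_fold b).choose_spec s

theorem cons_foldApprox_succ (n : ℕ) :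
    cons A ≫ foldApprox b (n + 1) = bangMap A (foldApprox b n) ≫ b := by
  rw [foldApprox_succ, ← Category.assoc, cons_uncons, Category.id_comp]

/-- At `a ⊗ s` both sides are suprema of the same chain shifted by one index: approximation `n + 1`
on the left is `b` applied to approximation `n` on the right. -/
theorem cons_fold : cons A ≫ fold b = bangMap A (fold b) ≫ b := by
  refine bang_hom_ext fun a s => ?_
  rw [comp_toFun, comp_toFun, bangMap_pair, cons_pair]
  have hdir := directedOn_range.2 (foldApprox_monotone b s).directed_le
  have h := ((pair_lifted_scott a).comp b.scott) (Set.range_nonempty _) hdir (fold_isLUB b s)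
  refine (fold_isLUB b (seqCons a s)).unique ⟨?_, fun z hz => h.2 ?_⟩
  · rintro _ ⟨n, rfl⟩
    refine (foldApprox_le_succ b n _).trans (h.1 ⟨_, ⟨n, rfl⟩, ?_⟩)
    have := congrArg (fun k => Hom.toFun k (pair a (lifted s))) (cons_foldApprox_succ b n)
    simp only [comp_toFun, cons_pair, bangMap_pair] at this
    exact this.symm
  · rintro _ ⟨_, ⟨n, rfl⟩, rfl⟩
    have := congrArg (fun k => Hom.toFun k (pair a (lifted s))) (cons_foldApprox_succ b n)
    simp only [comp_toFun, cons_pair, bangMap_pair] at this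
    exact this.symm.trans_le (hz ⟨n + 1, rfl⟩)

/-- An algebra map carries the approximations of the identity to those of `fold b`; the base case is
strictness of `h`. -/
theorem foldApprox_cons_comp {h : seqs A ⟶ B} (hh : cons A ≫ h = bangMap A h ≫ b) (n : ℕ) :
    foldApprox (cons A) n ≫ h = foldApprox b n := by
  induction n with
  | zero => exact hom_ext' fun _ => h.strict
  | succ n ih =>
    rw [foldApprox_succ, foldApprox_succ, Category.assoc, Category.assoc, hh, ← ih, bangMap_comp,
      Category.assoc]

theorem foldApprox_cons_succ (n : ℕ) (s : seqs A) :
    (foldApprox (cons A) (n + 1)).toFun s =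
      seqCons (s.1 0) ((foldApprox (cons A) n).toFun (seqTail s)) := by
  rw [foldApprox_succ_apply, cons_pair]

theorem foldApprox_cons_le (n : ℕ) (s : seqs A) : (foldApprox (cons A) n).toFun s ≤ s := by
  induction n generalizing s with
  | zero => exact bot_le
  | succ n ih =>
    rw [foldApprox_cons_succ]
    calc _ ≤ seqCons (s.1 0) (seqTail s) :=
          ((DCPO.scott_prodMk_left _).comp seqCons_scott).monotone (ih _)
      _ = s := seqCons_head_tail s

/-- Approximation `n` of the identity preserves the first `n` entries of a sequence. -/
theorem foldApprox_cons_apply {n m : ℕ} (h : m < n) (s : seqs A) :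
    ((foldApprox (cons A) n).toFun s).1 m = s.1 m := by
  induction n generalizing m s with
  | zero => exact absurd h (Nat.not_lt_zero _)
  | succ n ih =>
    rw [foldApprox_cons_succ]
    cases m with
    | zero => rfl
    | succ m =>
      change guard _ (((foldApprox (cons A) n).toFun (seqTail s)).1 m) = _
      rw [ih (Nat.lt_of_succ_lt_succ h)]
      exact congrArg (fun t : seqs A => t.1 (m + 1)) (seqCons_head_tail s)

theorem foldApprox_cons_isLUB (s : seqs A) :
    IsLUB (Set.range fun n => (foldApprox (cons A) n).toFun s) s := by
  refine ⟨?_, fun z hz n => ?_⟩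
  · rintro _ ⟨n, rfl⟩
    exact foldApprox_cons_le n s
  -- The order is pointwise, and entry `n` is already correct in approximation `n + 1`.
  · have : (foldApprox (cons A) (n + 1)).toFun s ≤ z := hz ⟨n + 1, rfl⟩
    exact (foldApprox_cons_apply n.lt_succ_self s).symm.trans_le (this n)

/-- Each `s` is the supremum of its approximations; `h` preserves it and sends the chain to the one
defining `fold b`. -/
theorem eq_fold {h : seqs A ⟶ B} (hh : cons A ≫ h = bangMap A h ≫ b) : h = fold b := by
  refine hom_ext' fun s => ?_
  have hdir := directedOn_range.2 (foldApprox_monotone (cons A) s).directed_le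
  have := h.scott (Set.range_nonempty _) hdir (foldApprox_cons_isLUB s)
  rw [← Set.range_comp] at this
  refine this.unique ?_
  convert fold_isLUB b s using 3 with n
  exact congrArg (fun k => Hom.toFun k s) (foldApprox_cons_comp b hh n)

end Fold

/-! ### Finality of the strict sequences. -/

section Unfold

variable {A B : PointedDCPO.{u}} (c : B ⟶ smash A (liftObj B.toDCPO))

/-- The first entry of the value of a coalgebra. -/
def coalgHead : liftObj B.toDCPO ⟶ A :=
  extend ⟨fun x => (c.toFun x).1.1, (c.scott.comp smash_val_scott).comp ScottContinuous.fst⟩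

/-- The second entry of the value of a coalgebra. -/
def coalgNext : liftObj B.toDCPO ⟶ liftObj B.toDCPO :=
  extend ⟨fun x => (c.toFun x).1.2, (c.scott.comp smash_val_scott).comp ScottContinuous.snd⟩

theorem coalg_eq_pair (x : B) : c.toFun x =
    pair ((coalgHead c).toFun (lifted x)) ((coalgNext c).toFun (lifted x)) :=
  (pair_val (c.toFun x)).symm

/-- The entries of an element of the smash product vanish together, so a bottom head means a bottom
next state, whose head is `⊥`. This makes the unfolded sequence strict. -/
theorem coalgHead_next_eq_bot {t : liftObj B.toDCPO} (h : (coalgHead c).toFun t = ⊥) :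
    (coalgHead c).toFun ((coalgNext c).toFun t) = ⊥ := by
  have : (coalgNext c).toFun t = ⊥ := by
    revert h
    exact lift_cases (P := fun t => (coalgHead c).toFun t = ⊥ → (coalgNext c).toFun t = ⊥)
      (fun _ => rfl) (fun x => (c.toFun x).2.1) t
  rw [this]
  rfl

theorem coalgNext_iterate_scott (n : ℕ) : ScottContinuous ((coalgNext c).toFun^[n]) := by
  induction n with
  | zero => exact ScottContinuous.id
  | succ n ih => exact (coalgNext c).scott.comp ih

/-- The coalgebra map to the strict sequences. -/
def unfold : B ⟶ seqs A where
  toFun x := (⟨fun n => (coalgHead c).toFun ((coalgNext c).toFun^[n] (lifted x)), fun n h => by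
    change (coalgHead c).toFun ((coalgNext c).toFun^[n + 1] (lifted x)) = ⊥
    rw [Function.iterate_succ_apply']
    exact coalgHead_next_eq_bot c h⟩ : StrictSeq A)
  scott := .subtype_mk (.pi fun n =>
    (lifted_scott.comp (coalgNext_iterate_scott c n)).comp (coalgHead c).scott)
  strict := seqs_ext (seqs_apply_eq_bot _ (by
    change (c.toFun ⊥).1.1 = ⊥
    rw [c.strict]
    rfl))

theorem unfold_uncons : c ≫ bangMap A (unfold c) = unfold c ≫ uncons A := by
  refine hom_ext' fun x => ?_
  -- If the next state is a genuine `y`, dropping the head of the orbit of `x` gives the orbit of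
  -- `y`.
  have htail (y : B) (hy : (coalgNext c).toFun (lifted x) = lifted y) :
      seqTail ((unfold c).toFun x) = (unfold c).toFun y := seqs_ext fun n => by
    change (coalgHead c).toFun ((coalgNext c).toFun^[n] ((coalgNext c).toFun (lifted x))) = _
    rw [hy]
    rfl
  rw [comp_toFun, comp_toFun, uncons_apply, coalg_eq_pair]
  have hhead : ((unfold c).toFun x).1 0 = (coalgHead c).toFun (lifted x) := rfl
  have hiff := (c.toFun x).2
  change (coalgHead c).toFun (lifted x) = ⊥ ↔ (coalgNext c).toFun (lifted x) = ⊥ at hiff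
  rw [hhead]
  generalize (coalgHead c).toFun (lifted x) = a at *
  generalize (coalgNext c).toFun (lifted x) = t at *
  revert t
  -- When the next state is `⊥`, the smash condition makes the head `⊥`, so the unknown tail is
  -- irrelevant.
  refine lift_cases (fun _ h => ?_) (fun y htail _ => ?_)
  · rw [h.2 rfl, pair_bot_left, pair_bot_left, Hom.strict]
  · refine (bangMap_pair (unfold c) a y).trans ?_
    rw [htail y rfl]

theorem eq_comp_cons {g : B ⟶ seqs A} (hg : c ≫ bangMap A g = g ≫ uncons A) :
    g = c ≫ bangMap A g ≫ cons A := by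
  rw [← Category.assoc, hg, Category.assoc, uncons_cons, Category.comp_id]

/-- By `eq_comp_cons`, `g x` is the head of `x` followed by `g` of its next state, so entry `n + 1`
at `x` depends only on entry `n` at that state. -/
theorem coalg_hom_unique {g g' : B ⟶ seqs A} (hg : c ≫ bangMap A g = g ≫ uncons A)
    (hg' : c ≫ bangMap A g' = g' ≫ uncons A) : g = g' := by
  suffices ∀ n x, (g.toFun x).1 n = (g'.toFun x).1 n from
    hom_ext' fun x => seqs_ext fun n => this n x
  intro n
  induction n with
  | zero =>
    intro x
    rw [eq_comp_cons c hg, eq_comp_cons c hg', comp_toFun, comp_toFun, comp_toFun, comp_toFun,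
      coalg_eq_pair]
    generalize (coalgNext c).toFun (lifted x) = t
    revert t
    refine lift_cases ?_ fun y => ?_
    · rw [pair_bot_right, (bangMap A g).strict, (bangMap A g').strict]
    · rw [bangMap_pair, bangMap_pair, cons_pair, cons_pair]
      rfl
  | succ n ih =>
    intro x
    rw [eq_comp_cons c hg, eq_comp_cons c hg', comp_toFun, comp_toFun, comp_toFun, comp_toFun,
      coalg_eq_pair]
    generalize (coalgNext c).toFun (lifted x) = t
    revert t
    refine lift_cases ?_ fun y => ?_
    · rw [pair_bot_right, (bangMap A g).strict, (bangMap A g').strict]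
    · rw [bangMap_pair, bangMap_pair, cons_pair, cons_pair]
      exact congrArg (guard _) (ih y)

end Unfold

theorem bang_parametricallyAlgebraicallyCompact :
    ParametricallyAlgebraicallyCompact (forgetful.{u} ⋙ lifting.{u}) := fun A =>
  ⟨seqs A, seqsIso A,
    ⟨IsInitial.ofUniqueHom (fun B => ⟨fold (A := A) (B := B.a) B.str, (cons_fold _).symm⟩)
      (fun B m => Endofunctor.Algebra.ext (eq_fold (A := A) (B := B.a) B.str m.h.symm))⟩,
    ⟨IsTerminal.ofUniqueHom (fun B => ⟨unfold (A := A) (B := B.V) B.str, unfold_uncons _⟩)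
      (fun B m => Endofunctor.Coalgebra.ext
        (coalg_hom_unique (A := A) (B := B.V) B.str m.h (unfold_uncons _)))⟩⟩

end PointedDCPO

theorem mainTheorem7 :
    IsCLNLModelWithRecursion PointedDCPO.liftingAdj.{u} where
  cartesianClosed := ⟨DCPO.monoidalClosed⟩
  hasFiniteCoproducts_left := DCPO.hasFiniteCoproducts
  monoidalClosed := ⟨PointedDCPO.monoidalClosed⟩
  hasFiniteCoproducts_right := PointedDCPO.hasFiniteCoproducts
  symmetricMonoidal := PointedDCPO.liftingAdj_isSymmetricMonoidalAdjunction
  bang_compact := PointedDCPO.bang_parametricallyAlgebraicallyCompact
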